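/- Consider on $\mathbb{R}_x\times\mathbb{R}_v$ the system $$\partial_t f+v\,\partial_x f+B\,\partial_v f=0,\qquad \partial_tB+\partial_xB=\int_{\mathbb{R}} f\,dv,\qquad f(0,x,v)=f_0(x,v),\quad B(0,x)=B_0(x),\tag{$*$}$$ for $f=f(t,x,v)$ and $B=B(t,x)$. For $T>0$, a classical solution of $(*)$ on $[0,T]$ is a pair of real functions $f\in C^1([0,T]\times\mathbb{R}^2)$, $B\in C^1([0,T]\times\mathbb{R})$ satisfying $(*)$ for all $t\in[0,T]$ (with one-sided time derivatives at the endpoints), such that the functions $f(t,\cdot,\cdot)$, $t\in[0,T]$, all vanish outside one compact subset of $\mathbb{R}^2$. Let $T^*\in[0,\infty]$ be the supremum of all $T>0$ for which a classical solution on $[0,T]$ exists. **Theorem (Existence of classical solutions).** Let $f_0\in C^1_c(\mathbb{R}^2)$ and $B_0\in C^1(\mathbb{R})$. Then there is $T>0$ such that $(*)$ has a classical solution on $[0,T]$; for every $T>0$ there is at most one classical solution on $[0,T]$; and consequently there is a pair $(f,B)$, unique on $[0,T^*)$, whose restriction to $[0,T]$ is a classical solution for every $0<T<T^*$. Moreover,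 if $B_0$ is bounded and $T^*<\infty$, then this solution satisfies $$\limsup_{t\uparrow T^*}\Bigl(\|\partial_xf(t)\|_\infty+\|\partial_vf(t)\|_\infty\Bigr)=\infty .$$ -/

import Mathlib

open Set Filter Topology
open scoped ENNReal

namespace VlasovField

/-- `f` is continuously differentiable on `[0,T] × ℝ²` (up to the boundary in time) and the
functions `f t`, `t ∈ [0,T]`, are all supported in one compact set of the `(x,v)` plane. -/
def IsDensityClass (T : ℝ) (f : ℝ → ℝ → ℝ → ℝ) : Prop :=
  ContDiffOn ℝ 1 (fun p : ℝ × ℝ × ℝ => f p.1 p.2.1 p.2.2) (Icc 0 T ×ˢ univ) ∧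
  ∃ K : Set (ℝ × ℝ), IsCompact K ∧ ∀ t ∈ Icc 0 T, ∀ x v : ℝ, (x, v) ∉ K → f t x v = 0

/-- `B` is continuously differentiable on `[0,T] × ℝ` (up to the boundary in time). -/
def IsFieldClass (T : ℝ) (B : ℝ → ℝ → ℝ) : Prop :=
  ContDiffOn ℝ 1 (fun p : ℝ × ℝ => B p.1 p.2) (Icc 0 T ×ˢ univ)

/-- `(f, B)` is a classical solution on `[0,T]`, `T > 0`, of
`∂ₜ f + v ∂ₓ f + B ∂ᵥ f = 0`, `∂ₜ B + ∂ₓ B = ∫ f dv`, with `f(0) = f₀` and `B(0) = B₀`.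
Only the values of `f` and `B` at times in `[0,T]` matter; the time derivatives at `0` and `T`
are one-sided. -/
structure IsClassicalSolution (f₀ : ℝ × ℝ → ℝ) (B₀ : ℝ → ℝ) (T : ℝ)
    (f : ℝ → ℝ → ℝ → ℝ) (B : ℝ → ℝ → ℝ) : Prop where
  pos : 0 < T
  density : IsDensityClass T f
  field : IsFieldClass T B
  vlasov : ∀ t ∈ Icc 0 T, ∀ x v : ℝ,
    derivWithin (fun s => f s x v) (Icc 0 T) t + v * deriv (fun y => f t y v) x
      + B t x * deriv (fun w => f t x w) v = 0
  transport : ∀ t ∈ Icc 0 T, ∀ x : ℝ,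
    derivWithin (fun s => B s x) (Icc 0 T) t + deriv (fun y => B t y) x = ∫ v, f t x v
  init_density : ∀ x v : ℝ, f 0 x v = f₀ (x, v)
  init_field : ∀ x : ℝ, B 0 x = B₀ x

/-- The maximal lifespan: the supremum of all `T > 0` such that a classical solution with the
given data exists on `[0,T]`. -/
noncomputable def lifespan (f₀ : ℝ × ℝ → ℝ) (B₀ : ℝ → ℝ) : ℝ≥0∞ :=
  ⨆ (T : ℝ) (_ : ∃ f B, IsClassicalSolution f₀ B₀ T f B), ENNReal.ofReal T

/-- `(f, B)` is a classical solution on `[0, T*)`, with `T*` the maximal lifespan. -/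
def IsMaximalSolution (f₀ : ℝ × ℝ → ℝ) (B₀ : ℝ → ℝ)
    (f : ℝ → ℝ → ℝ → ℝ) (B : ℝ → ℝ → ℝ) : Prop :=
  ∀ T : ℝ, 0 < T → ENNReal.ofReal T < lifespan f₀ B₀ → IsClassicalSolution f₀ B₀ T f B

/-- `‖∂ₓ f(t)‖_∞ + ‖∂ᵥ f(t)‖_∞`, the suprema being taken over all `(x,v)`, in `[0,∞]`. -/
noncomputable def gradientNorm (f : ℝ → ℝ → ℝ → ℝ) (t : ℝ) : ℝ≥0∞ :=
  (⨆ (x : ℝ) (v : ℝ), ‖deriv (fun y => f t y v) x‖ₑ) +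
    ⨆ (x : ℝ) (v : ℝ), ‖deriv (fun w => f t x w) v‖ₑ

end VlasovField

/-!
Uniqueness and the a priori bounds come from the maximum principle: a quantity transported by
`∂ₜ + v ∂ₓ + B ∂ᵥ` with a bounded source cannot grow faster than the source, and along the lines
`x - t = const` the field is an integral of the charge. This yields an exponential bound for the
velocity support, hence bounds for the support and the field on bounded time intervals.

For local existence, the velocity and the field are truncated and the field equation is written
along characteristics, so that the flow and the field form a fixed point of an integral operator
which contracts a set of Lipschitz pairs on a short time interval. The fixed point is a priori only
Lipschitz; it is `C¹` because the integral equations propagate a modulus of continuity of the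
difference quotients. Finite speed of propagation removes the truncation. The existence time
depends only on the size of the support and on Lipschitz bounds for the data near it. A bounded
density gradient keeps these under control up to `T*`, so the solution could be restarted close to
a finite `T*` and extended beyond it.
-/

namespace VlasovField

/-- The increments `F i (z + h) - F i z` over small steps `h`, taken at nearby base points `z`,
differ by at most `ε ‖h‖`, uniformly in `i`. For differentiable functions this says that the
derivatives have local oscillation at most `ε`; it is phrased through increments so that it can be
tested before differentiability is known. -/
def IncrementOscLE {ι E G : Type*} [NormedAddCommGroup E] [NormedAddCommGroup G]
    (ε : ℝ) (F : ι → E → G) : Prop :=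
  ∃ r > 0, ∀ i z z' h, ‖z - z'‖ ≤ r → ‖h‖ ≤ r →
    ‖F i (z + h) - F i z - (F i (z' + h) - F i z')‖ ≤ ε * ‖h‖

/-- The family `F` has increments of arbitrarily small local oscillation. For Lipschitz functions on
a finite-dimensional space this amounts to differentiability with derivatives that are uniformly
continuous, uniformly in the index. -/
def UniformC1 {ι E G : Type*} [NormedAddCommGroup E] [NormedAddCommGroup G]
    (F : ι → E → G) : Prop :=
  ∀ ε > 0, IncrementOscLE ε F

section IncrementOscLE

variable {ι κ E E' G G' : Type*} [NormedAddCommGroup E] [NormedAddCommGroup E']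
  [NormedAddCommGroup G] [NormedAddCommGroup G']
  {F F' : ι → E → G} {ε ε' : ℝ}

namespace IncrementOscLE

theorem of_lipschitz {L : ℝ} (hF : ∀ i z z', ‖F i z - F i z'‖ ≤ L * ‖z - z'‖) :
    IncrementOscLE (2 * L) F := by
  refine ⟨1, one_pos, fun i z z' h _ _ => ?_⟩
  have hz := hF i (z + h) z
  have hz' := hF i (z' + h) z'
  rw [add_sub_cancel_left] at hz hz'
  calc ‖F i (z + h) - F i z - (F i (z' + h) - F i z')‖
      ≤ ‖F i (z + h) - F i z‖ + ‖F i (z' + h) - F i z'‖ := norm_sub_le _ _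
    _ ≤ 2 * L * ‖h‖ := by linarith

theorem mono (h : IncrementOscLE ε F) (hε : ε ≤ ε') : IncrementOscLE ε' F := by
  obtain ⟨r, hr, H⟩ := h
  exact ⟨r, hr, fun i z z' h hz hh => (H i z z' h hz hh).trans (by gcongr)⟩

theorem add (h : IncrementOscLE ε F) (h' : IncrementOscLE ε' F') :
    IncrementOscLE (ε + ε') (fun i z => F i z + F' i z) := by
  obtain ⟨r, hr, H⟩ := h
  obtain ⟨r', hr', H'⟩ := h'
  refine ⟨min r r', lt_min hr hr', fun i z z' h hz hh => ?_⟩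
  have hF := H i z z' h (hz.trans (min_le_left _ _)) (hh.trans (min_le_left _ _))
  have hF' := H' i z z' h (hz.trans (min_le_right _ _)) (hh.trans (min_le_right _ _))
  calc ‖F i (z + h) + F' i (z + h) - (F i z + F' i z)
          - (F i (z' + h) + F' i (z' + h) - (F i z' + F' i z'))‖
      = ‖(F i (z + h) - F i z - (F i (z' + h) - F i z'))
          + (F' i (z + h) - F' i z - (F' i (z' + h) - F' i z'))‖ := by congr 1; abel
    _ ≤ ε * ‖h‖ + ε' * ‖h‖ := (norm_add_le _ _).trans (add_le_add hF hF')
    _ = (ε + ε') * ‖h‖ := by ring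

theorem prodMk {H : ι → E → G'} (hF : IncrementOscLE ε F) (hH : IncrementOscLE ε H) :
    IncrementOscLE ε (fun i z => (F i z, H i z)) := by
  obtain ⟨r, hr, hF⟩ := hF
  obtain ⟨r', hr', hH⟩ := hH
  refine ⟨min r r', lt_min hr hr', fun i z z' h hz hh => norm_prod_le_iff.2 ⟨?_, ?_⟩⟩
  · exact hF i z z' h (hz.trans (min_le_left _ _)) (hh.trans (min_le_left _ _))
  · exact hH i z z' h (hz.trans (min_le_right _ _)) (hh.trans (min_le_right _ _))

theorem reindex (h : IncrementOscLE ε F) (e : κ → ι) : IncrementOscLE ε (fun k => F (e k)) := by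
  obtain ⟨r, hr, H⟩ := h
  exact ⟨r, hr, fun k => H (e k)⟩

theorem comp_affine (h : IncrementOscLE ε F) (hε : 0 ≤ ε) {A : E' → E} (hA : ∀ x, ‖A x‖ ≤ ‖x‖)
    {g : ι → E' → E} (hg : ∀ i x y, g i (x + y) = g i x + A y) :
    IncrementOscLE ε (fun i x => F i (g i x)) := by
  obtain ⟨r, hr, H⟩ := h
  refine ⟨r, hr, fun i z z' h hz hh => ?_⟩
  have hgz : g i z - g i z' = A (z - z') := by
    rw [sub_eq_iff_eq_add', ← hg, add_sub_cancel]
  simp only [hg]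
  calc ‖F i (g i z + A h) - F i (g i z) - (F i (g i z' + A h) - F i (g i z'))‖
      ≤ ε * ‖A h‖ := H i _ _ _ (hgz ▸ (hA _).trans hz) ((hA _).trans hh)
    _ ≤ ε * ‖h‖ := by gcongr; exact hA h

theorem comp {Z : ι → E' → E} {K L : ℝ} (hF : IncrementOscLE ε F) (hε : 0 ≤ ε) (hK : 0 ≤ K)
    (hFK : ∀ i z z', ‖F i z - F i z'‖ ≤ K * ‖z - z'‖) (hZ : IncrementOscLE ε' Z) (hL : 0 ≤ L)
    (hZL : ∀ i z z', ‖Z i z - Z i z'‖ ≤ L * ‖z - z'‖) :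
    IncrementOscLE (L * ε + K * ε') (fun i z => F i (Z i z)) := by
  obtain ⟨r, hr, hF⟩ := hF
  obtain ⟨r', hr', hZ⟩ := hZ
  refine ⟨min (r / (L + 1)) r', by positivity, fun i z z' h hz hh => ?_⟩
  have small : ∀ y : E', ‖y‖ ≤ min (r / (L + 1)) r' → L * ‖y‖ ≤ r := fun y hy => by
    have := (le_div_iff₀ (by positivity)).1 (hy.trans (min_le_left _ _))
    linarith [norm_nonneg y]
  set k := Z i (z + h) - Z i z with hk
  have hkh : ‖k‖ ≤ L * ‖h‖ := by simpa using hZL i (z + h) z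
  have osc_F := hF i (Z i z) (Z i z') k ((hZL i z z').trans (small _ hz)) (hkh.trans (small _ hh))
  have osc_Z : ‖Z i z' + k - Z i (z' + h)‖ ≤ ε' * ‖h‖ := by
    convert hZ i z z' h (hz.trans (min_le_right _ _)) (hh.trans (min_le_right _ _)) using 2
    rw [hk]; abel
  rw [hk, add_sub_cancel, ← hk] at osc_F
  calc ‖F i (Z i (z + h)) - F i (Z i z) - (F i (Z i (z' + h)) - F i (Z i z'))‖
      = ‖(F i (Z i (z + h)) - F i (Z i z) - (F i (Z i z' + k) - F i (Z i z')))
          + (F i (Z i z' + k) - F i (Z i (z' + h)))‖ := by congr 1; abel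
    _ ≤ ε * ‖k‖ + K * ‖Z i z' + k - Z i (z' + h)‖ :=
        (norm_add_le _ _).trans (add_le_add osc_F (hFK i _ _))
    _ ≤ ε * (L * ‖h‖) + K * (ε' * ‖h‖) := by gcongr
    _ = (L * ε + K * ε') * ‖h‖ := by ring

theorem intervalIntegral [NormedSpace ℝ G] {H : ι → ℝ → E → G} {l : ℝ} (hε : 0 ≤ ε)
    (hH : IncrementOscLE ε (fun (p : ι × ℝ) z => H p.1 p.2 z))
    (hc : ∀ i z, Continuous fun τ => H i τ z) {a b : ι → ℝ} (hl : ∀ i, |b i - a i| ≤ l) :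
    IncrementOscLE (l * ε) (fun i z => ∫ τ in a i..b i, H i τ z) := by
  obtain ⟨r, hr, hH⟩ := hH
  refine ⟨r, hr, fun i z z' h hz hh => ?_⟩
  have hi : ∀ z, IntervalIntegrable (fun τ => H i τ z) MeasureTheory.volume (a i) (b i) :=
    fun z => (hc i z).intervalIntegrable _ _
  simp only
  rw [← intervalIntegral.integral_sub (hi _) (hi _), ← intervalIntegral.integral_sub (hi _) (hi _),
    ← intervalIntegral.integral_sub ((hi _).sub (hi _)) ((hi _).sub (hi _))]
  calc _ ≤ ε * ‖h‖ * |b i - a i| := intervalIntegral.norm_integral_le_of_norm_le_const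
        fun τ _ => hH (i, τ) z z' h hz hh
    _ ≤ ε * ‖h‖ * l := by gcongr; exact hl i
    _ = l * ε * ‖h‖ := by ring

end IncrementOscLE

theorem UniformC1.of_hasCompactSupport [NormedSpace ℝ E] [NormedSpace ℝ G] {f : E → G}
    (hf : ContDiff ℝ 1 f) (hc : HasCompactSupport f) : UniformC1 (fun _ : ι => f) := by
  intro ε hε
  have huc : UniformContinuous (fderiv ℝ f) :=
    (hc.fderiv ℝ).uniformContinuous_of_continuous (hf.continuous_fderiv one_ne_zero)
  obtain ⟨r, hr, H⟩ := Metric.uniformContinuous_iff.1 huc ε hε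
  refine ⟨r / 2, by positivity, fun _ z z' h hz _ => ?_⟩
  have hd := hf.differentiable one_ne_zero
  have hderiv : ∀ y ∈ (univ : Set E), HasFDerivWithinAt (fun y => f (z + y) - f (z' + y))
      (fderiv ℝ f (z + y) - fderiv ℝ f (z' + y)) univ y := fun y _ =>
    (((hd (z + y)).hasFDerivAt.comp y ((hasFDerivAt_id y).const_add z)).sub
      ((hd (z' + y)).hasFDerivAt.comp y ((hasFDerivAt_id y).const_add z'))).hasFDerivWithinAt
  have hbound : ∀ y ∈ (univ : Set E), ‖fderiv ℝ f (z + y) - fderiv ℝ f (z' + y)‖ ≤ ε := by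
    intro y _
    rw [← dist_eq_norm]
    refine (H ?_).le
    rw [dist_eq_norm, add_sub_add_right_eq_sub]
    linarith
  have := convex_univ.norm_image_sub_le_of_norm_hasFDerivWithin_le hderiv hbound
    (mem_univ (0 : E)) (mem_univ h)
  simp only [add_zero, sub_zero] at this
  convert this using 2
  abel

end IncrementOscLE

section Differentiability

variable {ι E G : Type*} [NormedAddCommGroup E] [NormedSpace ℝ E] [NormedAddCommGroup G]
  [NormedSpace ℝ G]

theorem norm_sub_le_add_of_almost_linear {f : E → G} {z : E} {A A' : E →L[ℝ] G} {ε ε' : ℝ}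
    (hε : 0 ≤ ε + ε') (hA : ∀ᶠ h in 𝓝 (0 : E), ‖f (z + h) - f z - A h‖ ≤ ε * ‖h‖)
    (hA' : ∀ᶠ h in 𝓝 (0 : E), ‖f (z + h) - f z - A' h‖ ≤ ε' * ‖h‖) :
    ‖A - A'‖ ≤ ε + ε' := by
  refine ContinuousLinearMap.opNorm_le_of_nhds_zero hε ?_
  filter_upwards [hA, hA'] with h hAh hAh'
  calc ‖(A - A') h‖ = ‖(f (z + h) - f z - A' h) - (f (z + h) - f z - A h)‖ := by
        rw [sub_apply]; congr 1; abel
    _ ≤ (ε + ε') * ‖h‖ := (norm_sub_le _ _).trans (by linarith)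

theorem differentiableAt_of_almost_linear [CompleteSpace G] {f : E → G} {z : E}
    (H : ∀ ε > 0, ∃ A : E →L[ℝ] G, ∀ᶠ h in 𝓝 (0 : E), ‖f (z + h) - f z - A h‖ ≤ ε * ‖h‖) :
    DifferentiableAt ℝ f z := by
  obtain ⟨u, -, hu_pos, hu_lim⟩ := exists_seq_strictAnti_tendsto (0 : ℝ)
  choose A hA using fun n => H (u n) (hu_pos n)
  have hAA : ∀ n m, ‖A n - A m‖ ≤ u n + u m := fun n m =>
    norm_sub_le_add_of_almost_linear (add_pos (hu_pos n) (hu_pos m)).le (hA n) (hA m)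
  have hcauchy : CauchySeq A := by
    refine Metric.cauchySeq_iff'.2 fun ε hε => ?_
    obtain ⟨N, hN⟩ := eventually_atTop.1 (hu_lim.eventually (gt_mem_nhds (half_pos hε)))
    refine ⟨N, fun n hn => ?_⟩
    rw [dist_eq_norm]
    linarith [hAA n N, hN n hn, hN N le_rfl]
  obtain ⟨A', hA'⟩ := cauchySeq_tendsto_of_complete hcauchy
  have hAA' : ∀ n, ‖A n - A'‖ ≤ u n := fun n => by
    have := le_of_tendsto_of_tendsto' (tendsto_const_nhds.sub hA').norm
      (tendsto_const_nhds.add hu_lim) (hAA n)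
    rwa [add_zero] at this
  refine HasFDerivAt.differentiableAt (f' := A') ?_
  rw [hasFDerivAt_iff_isLittleO_nhds_zero, Asymptotics.isLittleO_iff]
  intro ε hε
  obtain ⟨n, hn⟩ := (hu_lim.eventually (gt_mem_nhds (half_pos hε))).exists
  filter_upwards [hA n] with h hh
  calc ‖f (z + h) - f z - A' h‖ = ‖(f (z + h) - f z - A n h) + (A n - A') h‖ := by
        rw [sub_apply]; congr 1; abel
    _ ≤ u n * ‖h‖ + u n * ‖h‖ := (norm_add_le _ _).trans
        (add_le_add hh ((A n - A').le_of_opNorm_le (hAA' n) h))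
    _ ≤ ε * ‖h‖ := by rw [← add_mul]; gcongr; linarith

namespace UniformC1

variable {F : ι → E → G}

/- By Rademacher's theorem there are points of differentiability `z₀` arbitrarily close to `z`, and
the derivative at `z₀` is an almost linear approximation at `z`. -/
theorem differentiable [FiniteDimensional ℝ E] [FiniteDimensional ℝ G] (H : UniformC1 F)
    {L : NNReal} (hL : ∀ i, LipschitzWith L (F i)) (i : ι) : Differentiable ℝ (F i) := by
  have : CompleteSpace G := FiniteDimensional.complete ℝ G
  intro z
  refine differentiableAt_of_almost_linear fun ε hε => ?_
  obtain ⟨r, hr, hF⟩ := H (ε / 2) (half_pos hε)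
  borelize E
  have hdense : Dense {x | DifferentiableAt ℝ (F i) x} := MeasureTheory.Measure.dense_of_ae
    ((hL i).ae_differentiableAt (μ := MeasureTheory.Measure.addHaar))
  obtain ⟨z₀, hz₀, hzr⟩ := hdense.exists_dist_lt z hr
  refine ⟨fderiv ℝ (F i) z₀, ?_⟩
  have hlin := (hasFDerivAt_iff_isLittleO_nhds_zero.1
    (DifferentiableAt.hasFDerivAt hz₀)).def (half_pos hε)
  filter_upwards [hlin, Metric.closedBall_mem_nhds (0 : E) hr] with h hlin hh
  rw [mem_closedBall_zero_iff] at hh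
  have hosc := hF i z z₀ h (by rw [← dist_eq_norm]; exact hzr.le) hh
  calc ‖F i (z + h) - F i z - fderiv ℝ (F i) z₀ h‖
      = ‖(F i (z + h) - F i z - (F i (z₀ + h) - F i z₀))
        + (F i (z₀ + h) - F i z₀ - fderiv ℝ (F i) z₀ h)‖ := by congr 1; abel
    _ ≤ ε * ‖h‖ := (norm_add_le _ _).trans (by linarith)

theorem norm_fderiv_sub_le (H : UniformC1 F) (hd : ∀ i, Differentiable ℝ (F i)) {ε : ℝ}
    (hε : 0 < ε) :
    ∃ r > 0, ∀ i z z', ‖z - z'‖ ≤ r → ‖fderiv ℝ (F i) z - fderiv ℝ (F i) z'‖ ≤ ε := by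
  obtain ⟨r, hr, hF⟩ := H ε hε
  refine ⟨r, hr, fun i z z' hz => ?_⟩
  have translate : ∀ y, HasFDerivAt (fun h => F i (y + h)) (fderiv ℝ (F i) y) 0 := fun y =>
    HasFDerivAt.comp (0 : E) (by simpa using (hd i y).hasFDerivAt) ((hasFDerivAt_id 0).const_add y)
  refine ((translate z).sub (translate z')).le_of_lip' hε.le ?_
  filter_upwards [Metric.closedBall_mem_nhds (0 : E) hr] with h hh
  rw [mem_closedBall_zero_iff] at hh
  simp only [Pi.sub_apply, add_zero, sub_zero]
  convert hF i z z' h hz hh using 2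
  abel

theorem norm_remainder_le (H : UniformC1 F) (hd : ∀ i, Differentiable ℝ (F i)) {ε : ℝ}
    (hε : 0 < ε) :
    ∃ r > 0, ∀ i z h, ‖h‖ ≤ r → ‖F i (z + h) - F i z - fderiv ℝ (F i) z h‖ ≤ ε * ‖h‖ := by
  obtain ⟨r, hr, hF⟩ := H.norm_fderiv_sub_le hd hε
  refine ⟨r, hr, fun i z h hh => ?_⟩
  have := (convex_closedBall z r).norm_image_sub_le_of_norm_fderiv_le' (𝕜 := ℝ) (f := F i)
    (φ := fderiv ℝ (F i) z) (C := ε) (x := z) (y := z + h) (fun x _ => hd i x)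
    (fun x hx => hF i x z (by rwa [← dist_eq_norm])) (Metric.mem_closedBall_self hr.le)
    (by simpa [dist_eq_norm] using hh)
  rwa [add_sub_cancel_left] at this

theorem tendstoUniformly_slope (H : UniformC1 F) (hd : ∀ i, Differentiable ℝ (F i)) (h : E) :
    TendstoUniformly (fun (s : ℝ) (p : ι × E) => s⁻¹ • (F p.1 (p.2 + s • h) - F p.1 p.2))
      (fun p => fderiv ℝ (F p.1) p.2 h) (𝓝[≠] 0) := by
  rw [Metric.tendstoUniformly_iff]
  intro ε hε
  obtain ⟨r, hr, hF⟩ := H.norm_remainder_le hd (ε := ε / (‖h‖ + 1)) (by positivity)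
  have hsmall : ∀ᶠ s in 𝓝[≠] (0 : ℝ), ‖s • h‖ < r := by
    have : Tendsto (fun s : ℝ => ‖s • h‖) (𝓝 0) (𝓝 0) :=
      Continuous.tendsto' (by fun_prop) _ _ (by simp)
    exact nhdsWithin_le_nhds (this.eventually (gt_mem_nhds hr))
  filter_upwards [hsmall, self_mem_nhdsWithin] with s hs hs0 p
  rw [dist_comm, dist_eq_norm]
  calc ‖s⁻¹ • (F p.1 (p.2 + s • h) - F p.1 p.2) - fderiv ℝ (F p.1) p.2 h‖
      = ‖s⁻¹ • (F p.1 (p.2 + s • h) - F p.1 p.2 - fderiv ℝ (F p.1) p.2 (s • h))‖ := by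
        rw [map_smul, smul_sub _ _ (s • _), inv_smul_smul₀ hs0]
    _ ≤ ‖s‖⁻¹ * (ε / (‖h‖ + 1) * (‖s‖ * ‖h‖)) := by
        rw [norm_smul, norm_inv, ← norm_smul]
        gcongr
        exact hF _ _ _ hs.le
    _ = ε * (‖h‖ / (‖h‖ + 1)) := by
        have : ‖s‖ ≠ 0 := norm_ne_zero_iff.2 hs0
        field_simp
    _ < ε * 1 := by gcongr; rw [div_lt_one (by positivity)]; linarith
    _ = ε := mul_one ε

theorem continuous_fderiv_apply [TopologicalSpace ι] (H : UniformC1 F)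
    (hd : ∀ i, Differentiable ℝ (F i)) (hc : Continuous fun p : ι × E => F p.1 p.2) (h : E) :
    Continuous fun p : ι × E => fderiv ℝ (F p.1) p.2 h := by
  refine (H.tendstoUniformly_slope hd h).continuous (Frequently.of_forall fun s => ?_)
  have shifted : Continuous fun p : ι × E => F p.1 (p.2 + s • h) :=
    hc.comp (continuous_fst.prodMk (continuous_snd.add continuous_const))
  exact (shifted.sub hc).const_smul _

end UniformC1

end Differentiability

section RealAnalysis

/- Iterating `A ↦ c + A / 2` from `A₀` stays in `S` and converges to `2 * c`. -/
theorem two_mul_mem_of_add_half_mem {S : Set ℝ} (hS : IsClosed S) {c A₀ : ℝ} (hc : 0 ≤ c)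
    (hA₀ : 0 ≤ A₀) (h₀ : A₀ ∈ S) (h : ∀ A ∈ S, 0 ≤ A → c + A / 2 ∈ S) : 2 * c ∈ S := by
  have hmem : ∀ n : ℕ, 0 ≤ 2 * c + (A₀ - 2 * c) * (1 / 2) ^ n ∧
      2 * c + (A₀ - 2 * c) * (1 / 2) ^ n ∈ S := by
    intro n
    induction n with
    | zero => simpa using ⟨hA₀, h₀⟩
    | succ n ih =>
      have hstep : 2 * c + (A₀ - 2 * c) * (1 / 2) ^ (n + 1) =
          c + (2 * c + (A₀ - 2 * c) * (1 / 2) ^ n) / 2 := by ring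
      rw [hstep]
      exact ⟨by linarith [ih.1], h _ ih.2 ih.1⟩
  have hlim : Tendsto (fun n : ℕ => 2 * c + (A₀ - 2 * c) * (1 / 2) ^ n) atTop (𝓝 (2 * c)) := by
    simpa using ((tendsto_pow_atTop_nhds_zero_of_lt_one (r := (1 / 2 : ℝ)) (by norm_num)
      (by norm_num)).const_mul (A₀ - 2 * c)).const_add (2 * c)
  exact hS.mem_of_tendsto hlim (Eventually.of_forall fun n => (hmem n).2)

theorem nonneg_of_hasDerivWithinAt_of_isMaxOn_Icc {T t d : ℝ} {g : ℝ → ℝ} (ht : t ∈ Ioc 0 T)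
    (hg : HasDerivWithinAt g d (Icc 0 T) t) (hmax : IsMaxOn g (Icc 0 T) t) : 0 ≤ d := by
  have hleft : Ico 0 t ⊆ Icc 0 T := fun s hs => ⟨hs.1, hs.2.le.trans ht.2⟩
  have hslope := hg.mono hleft
  rw [hasDerivWithinAt_iff_tendsto_slope' (by simp)] at hslope
  have : (𝓝[Ico 0 t] t).NeBot := by
    rw [← mem_closure_iff_nhdsWithin_neBot, closure_Ico ht.1.ne]
    exact right_mem_Icc.2 ht.1.le
  refine ge_of_tendsto hslope ?_
  filter_upwards [self_mem_nhdsWithin] with s hs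
  rw [slope_def_field]
  exact div_nonneg_of_nonpos (sub_nonpos.2 (hmax (hleft hs))) (sub_nonpos.2 hs.2.le)

theorem abs_sub_le_of_abs_deriv_le {T : ℝ} {u u' β β' : ℝ → ℝ}
    (hu : ∀ s ∈ Icc 0 T, HasDerivWithinAt u (u' s) (Icc 0 T) s)
    (hβ : ∀ s, HasDerivAt β (β' s) s) (hb : ∀ s ∈ Icc 0 T, |u' s| ≤ β' s) {t : ℝ}
    (ht : t ∈ Icc 0 T) : |u t - u 0| ≤ β t - β 0 := by
  refine image_norm_le_of_norm_deriv_right_le_deriv_boundary' (f := fun s => u s - u 0)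
    (f' := u') (B := fun s => β s - β 0) (B' := β')
    (fun s hs => (hu s hs).continuousWithinAt.sub continuousWithinAt_const) ?_ (by simp)
    (fun s _ => ((hβ s).sub_const _).continuousAt.continuousWithinAt)
    (fun s _ => ((hβ s).sub_const _).hasDerivWithinAt) (fun s hs => hb s ⟨hs.1, hs.2.le⟩) ht
  exact fun s hs =>
    ((hu s ⟨hs.1, hs.2.le⟩).mono_of_mem_nhdsWithin (Icc_mem_nhdsGE_of_mem hs)).sub_const _

theorem hasDerivAt_div_mul_exp {l : ℝ} (hl : l ≠ 0) (c s : ℝ) :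
    HasDerivAt (fun s => c / l * Real.exp (l * s)) (c * Real.exp (l * s)) s := by
  refine (((hasDerivAt_id s).const_mul l).exp.const_mul (c / l)).congr_deriv ?_
  simp only [id]
  field_simp

theorem abs_integral_le_of_support {g : ℝ → ℝ} {r M : ℝ} (hr : 0 ≤ r)
    (hg : ∀ v, g v ≠ 0 → |v| ≤ r) (hM : ∀ v, |g v| ≤ M) : |∫ v, g v| ≤ 2 * r * M := by
  rw [← MeasureTheory.setIntegral_eq_integral_of_forall_compl_eq_zero (s := Icc (-r) r)
    fun v hv => by_contra fun h => hv (abs_le.1 (hg v h))]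
  calc |∫ v in Icc (-r) r, g v| ≤ M * MeasureTheory.volume.real (Icc (-r) r) :=
        MeasureTheory.norm_setIntegral_le_of_norm_le_const (f := g)
          measure_Icc_lt_top fun v _ => hM v
    _ = 2 * r * M := by rw [Real.volume_real_Icc_of_le (by linarith)]; ring

theorem integrable_of_support {g : ℝ → ℝ} {r : ℝ} (hc : Continuous g)
    (hg : ∀ v, g v ≠ 0 → |v| ≤ r) : MeasureTheory.Integrable g :=
  hc.integrable_of_hasCompactSupport (HasCompactSupport.intro (K := Icc (-r) r) isCompact_Icc
    fun v hv => by_contra fun h => hv (abs_le.1 (hg v h)))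

end RealAnalysis

/- At a positive maximum of `w - ε t` over `[0, T] × K` the space derivatives vanish and the time
derivative is at least `ε`. -/
theorem nonpos_of_transport_le {T : ℝ} {w : ℝ → ℝ → ℝ → ℝ} {K : Set (ℝ × ℝ)} (hK : IsCompact K)
    (hw : ContinuousOn (fun p : ℝ × ℝ × ℝ => w p.1 p.2.1 p.2.2) (Icc 0 T ×ˢ univ))
    (hwK : ∀ t ∈ Icc 0 T, ∀ x v, (x, v) ∉ K → w t x v ≤ 0)
    (h0 : ∀ x v, w 0 x v ≤ 0)
    (hd : ∀ t ∈ Icc 0 T, ∀ x v, 0 < w t x v → ∃ a b wt wx wv,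
      HasDerivWithinAt (fun s => w s x v) wt (Icc 0 T) t ∧ HasDerivAt (fun y => w t y v) wx x ∧
      HasDerivAt (fun u => w t x u) wv v ∧ wt + a * wx + b * wv ≤ 0) :
    ∀ t ∈ Icc 0 T, ∀ x v, w t x v ≤ 0 := by
  intro t₀ ht₀ x₀ v₀
  by_contra! hpos
  have hT0 : 0 ≤ T := ht₀.1.trans ht₀.2
  set ε := w t₀ x₀ v₀ / (2 * (T + 1)) with hε
  have hε0 : 0 < ε := by positivity
  have hεt : ε * t₀ ≤ w t₀ x₀ v₀ / 2 := by
    calc ε * t₀ ≤ ε * (T + 1) := by gcongr; linarith [ht₀.2]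
      _ = w t₀ x₀ v₀ / 2 := by rw [hε]; field_simp
  have hmem : (x₀, v₀) ∈ K := by_contra fun h => (hwK t₀ ht₀ x₀ v₀ h).not_gt hpos
  obtain ⟨⟨t, x, v⟩, ⟨ht, hxv⟩, hmax⟩ := (isCompact_Icc.prod hK).exists_isMaxOn
    ⟨(t₀, x₀, v₀), ⟨ht₀, hmem⟩⟩
    ((hw.mono (prod_mono_right (subset_univ K))).sub (by fun_prop :
      ContinuousOn (fun p : ℝ × ℝ × ℝ => ε * p.1) (Icc 0 T ×ˢ K)))
  have hmax' : ∀ s ∈ Icc 0 T, ∀ y u, (y, u) ∈ K → w s y u - ε * s ≤ w t x v - ε * t :=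
    fun s hs y u hyu => hmax (show (s, y, u) ∈ Icc 0 T ×ˢ K from ⟨hs, hyu⟩)
  have hwpos : 0 < w t x v := by
    linarith [hmax' t₀ ht₀ x₀ v₀ hmem, mul_nonneg hε0.le ht.1]
  have hspace : ∀ y u, w t y u ≤ w t x v := fun y u => by
    by_cases hyu : (y, u) ∈ K
    · linarith [hmax' t ht y u hyu]
    · exact (hwK t ht y u hyu).trans hwpos.le
  have ht0 : 0 < t := lt_of_le_of_ne ht.1 fun h => (h0 x v).not_gt (h ▸ hwpos)
  obtain ⟨a, b, wt, wx, wv, hwt, hwx, hwv, hle⟩ := hd t ht x v hwpos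
  have hwx0 : wx = 0 :=
    IsLocalMax.hasDerivAt_eq_zero (Eventually.of_forall fun y => hspace y v) hwx
  have hwv0 : wv = 0 :=
    IsLocalMax.hasDerivAt_eq_zero (Eventually.of_forall fun u => hspace x u) hwv
  have htime : 0 ≤ wt - ε * 1 := nonneg_of_hasDerivWithinAt_of_isMaxOn_Icc ⟨ht0, ht.2⟩
    (hwt.sub ((hasDerivWithinAt_id t _).const_mul ε)) fun s hs => hmax' s hs x v hxv
  rw [hwx0, hwv0] at hle
  linarith

section Class

variable {T : ℝ}

namespace IsDensityClass

variable {f g : ℝ → ℝ → ℝ → ℝ}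

theorem sub (hf : IsDensityClass T f) (hg : IsDensityClass T g) :
    IsDensityClass T fun t x v => f t x v - g t x v := by
  obtain ⟨hfd, K, hK, hfK⟩ := hf
  obtain ⟨hgd, K', hK', hgK'⟩ := hg
  refine ⟨hfd.sub hgd, K ∪ K', hK.union hK', fun t ht x v hxv => ?_⟩
  rw [mem_union, not_or] at hxv
  simp [hfK t ht x v hxv.1, hgK' t ht x v hxv.2]

theorem neg (hf : IsDensityClass T f) : IsDensityClass T fun t x v => -f t x v := by
  obtain ⟨hfd, K, hK, hfK⟩ := hf
  exact ⟨hfd.neg, K, hK, fun t ht x v hxv => by simp [hfK t ht x v hxv]⟩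

theorem continuousOn (hf : IsDensityClass T f) :
    ContinuousOn (fun p : ℝ × ℝ × ℝ => f p.1 p.2.1 p.2.2) (Icc 0 T ×ˢ univ) :=
  hf.1.continuousOn

theorem hasFDerivWithinAt (hf : IsDensityClass T f) {t : ℝ} (ht : t ∈ Icc 0 T) (x v : ℝ) :
    HasFDerivWithinAt (fun p : ℝ × ℝ × ℝ => f p.1 p.2.1 p.2.2)
      (fderivWithin ℝ (fun p : ℝ × ℝ × ℝ => f p.1 p.2.1 p.2.2) (Icc 0 T ×ˢ univ) (t, x, v))
      (Icc 0 T ×ˢ univ) (t, x, v) :=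
  (hf.1.differentiableOn one_ne_zero (t, x, v) ⟨ht, mem_univ _⟩).hasFDerivWithinAt

theorem hasDerivWithinAt_time (hf : IsDensityClass T f) {t : ℝ} (ht : t ∈ Icc 0 T) (x v : ℝ) :
    HasDerivWithinAt (fun s => f s x v) (derivWithin (fun s => f s x v) (Icc 0 T) t)
      (Icc 0 T) t :=
  ((hf.hasFDerivWithinAt ht x v).comp_hasDerivWithinAt (f := fun s => (s, x, v)) t
    ((hasDerivWithinAt_id t _).prodMk (hasDerivWithinAt_const t _ (x, v)))
    fun _ hs => ⟨hs, mem_univ _⟩).differentiableWithinAt.hasDerivWithinAt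

theorem hasDerivAt_position (hf : IsDensityClass T f) {t : ℝ} (ht : t ∈ Icc 0 T) (x v : ℝ) :
    HasDerivAt (fun y => f t y v) (deriv (fun y => f t y v) x) x := by
  refine DifferentiableAt.hasDerivAt (differentiableWithinAt_univ.1 ?_)
  exact ((hf.hasFDerivWithinAt ht x v).comp_hasDerivWithinAt (s := univ) (f := fun y => (t, y, v)) x
    ((hasDerivWithinAt_const x _ t).prodMk
      ((hasDerivWithinAt_id x _).prodMk (hasDerivWithinAt_const x _ v)))
    fun _ _ => ⟨ht, mem_univ _⟩).differentiableWithinAt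

theorem hasDerivAt_velocity_fderivWithin (hf : IsDensityClass T f) {t : ℝ} (ht : t ∈ Icc 0 T)
    (x v : ℝ) :
    HasDerivAt (fun w => f t x w) (fderivWithin ℝ (fun p : ℝ × ℝ × ℝ => f p.1 p.2.1 p.2.2)
      (Icc 0 T ×ˢ univ) (t, x, v) (0, 0, 1)) v := by
  rw [← hasDerivWithinAt_univ]
  exact (hf.hasFDerivWithinAt ht x v).comp_hasDerivWithinAt (s := univ) (f := fun w => (t, x, w)) v
    ((hasDerivWithinAt_const v _ t).prodMk
      ((hasDerivWithinAt_const v _ x).prodMk (hasDerivWithinAt_id v _)))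
    fun _ _ => ⟨ht, mem_univ _⟩

theorem hasDerivAt_velocity (hf : IsDensityClass T f) {t : ℝ} (ht : t ∈ Icc 0 T) (x v : ℝ) :
    HasDerivAt (fun w => f t x w) (deriv (fun w => f t x w) v) v :=
  (hf.hasDerivAt_velocity_fderivWithin ht x v).differentiableAt.hasDerivAt

theorem continuous_velocity (hf : IsDensityClass T f) {t : ℝ} (ht : t ∈ Icc 0 T) (x : ℝ) :
    Continuous fun v => f t x v :=
  continuous_iff_continuousAt.2 fun v => (hf.hasDerivAt_velocity ht x v).continuousAt

theorem exists_support (hf : IsDensityClass T f) :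
    ∃ r > 0, ∀ t ∈ Icc 0 T, ∀ x v, f t x v ≠ 0 → |x| ≤ r ∧ |v| ≤ r := by
  obtain ⟨K, hK, hfK⟩ := hf.2
  obtain ⟨r, hr0, hr⟩ := hK.isBounded.exists_pos_norm_le
  refine ⟨r, hr0, fun t ht x v h => ?_⟩
  have hmem : (x, v) ∈ K := by_contra fun hn => h (hfK t ht x v hn)
  exact norm_prod_le_iff.1 (hr _ hmem)

theorem exists_abs_le (hf : IsDensityClass T f) :
    ∃ C ≥ 0, ∀ t ∈ Icc 0 T, ∀ x v, |f t x v| ≤ C := by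
  obtain ⟨K, hK, hfK⟩ := hf.2
  obtain ⟨C, hC⟩ := (isCompact_Icc.prod hK).exists_bound_of_continuousOn
    (hf.continuousOn.mono (prod_mono_right (subset_univ K)))
  refine ⟨max C 0, le_max_right _ _, fun t ht x v => ?_⟩
  by_cases hxv : (x, v) ∈ K
  · exact (hC (t, x, v) ⟨ht, hxv⟩).trans (le_max_left _ _)
  · simp [hfK t ht x v hxv]

theorem exists_abs_deriv_velocity_le (hT : 0 < T) (hf : IsDensityClass T f) :
    ∃ C ≥ 0, ∀ t ∈ Icc 0 T, ∀ x v, |deriv (fun w => f t x w) v| ≤ C := by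
  obtain ⟨K, hK, hfK⟩ := hf.2
  have hcont := ((hf.1.continuousOn_fderivWithin ((uniqueDiffOn_Icc hT).prod uniqueDiffOn_univ)
    le_rfl).clm_apply (continuousOn_const (c := ((0, 0, 1) : ℝ × ℝ × ℝ)))).mono
    (prod_mono_right (subset_univ K))
  obtain ⟨C, hC⟩ := (isCompact_Icc.prod hK).exists_bound_of_continuousOn hcont
  refine ⟨max C 0, le_max_right _ _, fun t ht x v => ?_⟩
  by_cases hxv : (x, v) ∈ K
  · rw [(hf.hasDerivAt_velocity_fderivWithin ht x v).deriv]
    exact (hC (t, x, v) ⟨ht, hxv⟩).trans (le_max_left _ _)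
  · have hzero : (fun w => f t x w) =ᶠ[𝓝 v] fun _ => 0 := by
      filter_upwards [(Continuous.prodMk_right x).continuousAt
        (hK.isClosed.isOpen_compl.mem_nhds hxv)] with w hw using hfK t ht x w hw
    simp [hzero.deriv_eq]

theorem le_of_transport_le (hf : IsDensityClass T f) {a b : ℝ → ℝ → ℝ → ℝ} {β β' : ℝ → ℝ}
    (hβ : ∀ t, HasDerivAt β (β' t) t) (hβ0 : ∀ t ∈ Icc 0 T, 0 ≤ β t)
    (h0 : ∀ x v, f 0 x v ≤ β 0)
    (h : ∀ t ∈ Icc 0 T, ∀ x v, derivWithin (fun s => f s x v) (Icc 0 T) t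
      + a t x v * deriv (fun y => f t y v) x + b t x v * deriv (fun w => f t x w) v ≤ β' t) :
    ∀ t ∈ Icc 0 T, ∀ x v, f t x v ≤ β t := by
  have hβc : Continuous β := continuous_iff_continuousAt.2 fun t => (hβ t).continuousAt
  obtain ⟨K, hK, hfK⟩ := hf.2
  have key := nonpos_of_transport_le (w := fun t x v => f t x v - β t) hK
    (hf.continuousOn.sub (by fun_prop))
    (fun t ht x v hxv => by simpa [hfK t ht x v hxv] using hβ0 t ht)
    (fun x v => sub_nonpos.2 (h0 x v)) fun t ht x v _ =>
      ⟨a t x v, b t x v, _, _, _, (hf.hasDerivWithinAt_time ht x v).sub (hβ t).hasDerivWithinAt,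
        (hf.hasDerivAt_position ht x v).sub_const _, (hf.hasDerivAt_velocity ht x v).sub_const _,
        by linarith [h t ht x v]⟩
  exact fun t ht x v => sub_nonpos.1 (key t ht x v)

theorem abs_le_of_abs_transport_le (hf : IsDensityClass T f) {a b : ℝ → ℝ → ℝ → ℝ}
    {β β' : ℝ → ℝ} (hβ : ∀ t, HasDerivAt β (β' t) t) (hβ0 : ∀ t ∈ Icc 0 T, 0 ≤ β t)
    (h0 : ∀ x v, |f 0 x v| ≤ β 0)
    (h : ∀ t ∈ Icc 0 T, ∀ x v, |derivWithin (fun s => f s x v) (Icc 0 T) t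
      + a t x v * deriv (fun y => f t y v) x + b t x v * deriv (fun w => f t x w) v| ≤ β' t) :
    ∀ t ∈ Icc 0 T, ∀ x v, |f t x v| ≤ β t := by
  refine fun t ht x v => abs_le'.2 ⟨?_, ?_⟩
  · exact hf.le_of_transport_le hβ hβ0 (fun x v => (le_abs_self _).trans (h0 x v))
      (fun t ht x v => (le_abs_self _).trans (h t ht x v)) t ht x v
  · refine hf.neg.le_of_transport_le (a := a) (b := b) hβ hβ0
      (fun x v => (neg_le_abs _).trans (h0 x v)) (fun t ht x v => ?_) t ht x v
    simp only [derivWithin.fun_neg, deriv.fun_neg]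
    linarith [(abs_le.1 (h t ht x v)).1]

end IsDensityClass

namespace IsFieldClass

variable {B : ℝ → ℝ → ℝ}

theorem hasFDerivWithinAt (hB : IsFieldClass T B) {t : ℝ} (ht : t ∈ Icc 0 T) (x : ℝ) :
    HasFDerivWithinAt (fun p : ℝ × ℝ => B p.1 p.2)
      (fderivWithin ℝ (fun p : ℝ × ℝ => B p.1 p.2) (Icc 0 T ×ˢ univ) (t, x))
      (Icc 0 T ×ˢ univ) (t, x) :=
  (ContDiffOn.differentiableOn hB one_ne_zero (t, x) ⟨ht, mem_univ _⟩).hasFDerivWithinAt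

theorem hasDerivWithinAt_time (hB : IsFieldClass T B) {t : ℝ} (ht : t ∈ Icc 0 T) (x : ℝ) :
    HasDerivWithinAt (fun s => B s x) (fderivWithin ℝ (fun p : ℝ × ℝ => B p.1 p.2)
      (Icc 0 T ×ˢ univ) (t, x) (1, 0)) (Icc 0 T) t :=
  (hB.hasFDerivWithinAt ht x).comp_hasDerivWithinAt (f := fun s => (s, x)) t
    ((hasDerivWithinAt_id t _).prodMk (hasDerivWithinAt_const t _ x))
    fun _ hs => ⟨hs, mem_univ _⟩

theorem hasDerivAt_position (hB : IsFieldClass T B) {t : ℝ} (ht : t ∈ Icc 0 T) (x : ℝ) :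
    HasDerivAt (fun y => B t y) (fderivWithin ℝ (fun p : ℝ × ℝ => B p.1 p.2)
      (Icc 0 T ×ˢ univ) (t, x) (0, 1)) x := by
  rw [← hasDerivWithinAt_univ]
  exact (hB.hasFDerivWithinAt ht x).comp_hasDerivWithinAt (s := univ) (f := fun y => (t, y)) x
    ((hasDerivWithinAt_const x _ t).prodMk (hasDerivWithinAt_id x _))
    fun _ _ => ⟨ht, mem_univ _⟩

end IsFieldClass

end Class

namespace IsClassicalSolution

variable {T : ℝ} {f₀ : ℝ × ℝ → ℝ} {B₀ : ℝ → ℝ} {f g : ℝ → ℝ → ℝ → ℝ} {B D : ℝ → ℝ → ℝ}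

theorem hasDerivWithinAt_field_line (h : IsClassicalSolution f₀ B₀ T f B) {t : ℝ}
    (ht : t ∈ Icc 0 T) (y : ℝ) :
    HasDerivWithinAt (fun s => B s (y + s)) (∫ v, f t (y + t) v) (Icc 0 T) t := by
  have key := (h.field.hasFDerivWithinAt ht (y + t)).comp_hasDerivWithinAt (s := Icc 0 T)
    (f := fun s => (s, y + s)) t
    ((hasDerivWithinAt_id t _).prodMk ((hasDerivWithinAt_id t _).const_add y))
    fun _ hs => ⟨hs, mem_univ _⟩
  have hdir : ((1 : ℝ), (1 : ℝ)) = (1, 0) + (0, 1) := by simp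
  rwa [hdir, map_add, ← (h.field.hasDerivAt_position ht (y + t)).deriv,
    ← (h.field.hasDerivWithinAt_time ht (y + t)).derivWithin (uniqueDiffOn_Icc h.pos t ht),
    h.transport t ht] at key

section Uniqueness

variable {r A C l : ℝ}

theorem abs_field_sub_field_le (h : IsClassicalSolution f₀ B₀ T f B)
    (h' : IsClassicalSolution f₀ B₀ T g D) (hr : 0 ≤ r)
    (hf : ∀ t ∈ Icc 0 T, ∀ x v, f t x v ≠ 0 → |v| ≤ r)
    (hg : ∀ t ∈ Icc 0 T, ∀ x v, g t x v ≠ 0 → |v| ≤ r) (hl : 0 < l) (hA : 0 ≤ A)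
    (hfg : ∀ t ∈ Icc 0 T, ∀ x v, |f t x v - g t x v| ≤ A * Real.exp (l * t)) :
    ∀ t ∈ Icc 0 T, ∀ x, |B t x - D t x| ≤ 2 * r * A / l * Real.exp (l * t) := by
  intro t ht x
  have hcharge : ∀ s ∈ Icc 0 T, |(∫ v, f s (x - t + s) v) - ∫ v, g s (x - t + s) v|
      ≤ 2 * r * A * Real.exp (l * s) := fun s hs => by
    rw [← MeasureTheory.integral_sub
      (integrable_of_support (h.density.continuous_velocity hs _) (hf s hs _))
      (integrable_of_support (h'.density.continuous_velocity hs _) (hg s hs _)), mul_assoc]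
    refine abs_integral_le_of_support hr (fun v hv => ?_) (hfg s hs _)
    by_cases hf0 : f s (x - t + s) v = 0
    · exact hg s hs _ v fun hg0 => hv (by rw [hf0, hg0, sub_zero])
    · exact hf s hs _ v hf0
  have hline := abs_sub_le_of_abs_deriv_le
    (fun s hs => (h.hasDerivWithinAt_field_line hs (x - t)).sub
      (h'.hasDerivWithinAt_field_line hs (x - t)))
    (hasDerivAt_div_mul_exp hl.ne' (2 * r * A)) hcharge ht
  simp only [Pi.sub_apply, sub_add_cancel, h.init_field, h'.init_field, sub_self, sub_zero,
    mul_zero, Real.exp_zero, mul_one] at hline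
  have : 0 ≤ 2 * r * A / l := by positivity
  linarith

theorem abs_density_sub_density_le (h : IsClassicalSolution f₀ B₀ T f B)
    (h' : IsClassicalSolution f₀ B₀ T g D) (hA : 0 ≤ A) (hl : 0 < l)
    (hC : 0 ≤ C) (hgv : ∀ t ∈ Icc 0 T, ∀ x v, |deriv (fun w => g t x w) v| ≤ C)
    (hBD : ∀ t ∈ Icc 0 T, ∀ x, |B t x - D t x| ≤ A * Real.exp (l * t)) :
    ∀ t ∈ Icc 0 T, ∀ x v, |f t x v - g t x v| ≤ A * C / l * Real.exp (l * t) := by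
  refine (h.density.sub h'.density).abs_le_of_abs_transport_le (a := fun _ _ v => v)
    (b := fun t x _ => B t x) (hasDerivAt_div_mul_exp hl.ne' (A * C)) (fun t _ => by positivity)
    (fun x v => ?_) (fun t ht x v => ?_)
  · rw [h.init_density, h'.init_density, sub_self, abs_zero]
    positivity
  · have hderiv : derivWithin (fun s => f s x v - g s x v) (Icc 0 T) t
        + v * deriv (fun y => f t y v - g t y v) x
        + B t x * deriv (fun w => f t x w - g t x w) v
        = -((B t x - D t x) * deriv (fun w => g t x w) v) := by
      have hdt := ((h.density.hasDerivWithinAt_time ht x v).sub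
        (h'.density.hasDerivWithinAt_time ht x v)).derivWithin (uniqueDiffOn_Icc h.pos t ht)
      have hdx := ((h.density.hasDerivAt_position ht x v).sub
        (h'.density.hasDerivAt_position ht x v)).deriv
      have hdv := ((h.density.hasDerivAt_velocity ht x v).sub
        (h'.density.hasDerivAt_velocity ht x v)).deriv
      simp only [Pi.sub_def] at hdt hdx hdv
      rw [hdt, hdx, hdv]
      linear_combination h.vlasov t ht x v - h'.vlasov t ht x v
    rw [hderiv, abs_neg, abs_mul]
    calc |B t x - D t x| * |deriv (fun w => g t x w) v| ≤ A * Real.exp (l * t) * C :=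
          mul_le_mul (hBD t ht x) (hgv t ht x v) (abs_nonneg _) (by positivity)
      _ = A * C * Real.exp (l * t) := by ring

/- A bound `A e^{lt}` for the difference of the densities improves to `(A / 2) e^{lt}` as soon as
`4 r C ≤ l²`, where `r` bounds the velocities and `C` the velocity derivative. -/
theorem density_eq_of_eq_data (h : IsClassicalSolution f₀ B₀ T f B)
    (h' : IsClassicalSolution f₀ B₀ T g D) :
    ∀ t ∈ Icc 0 T, ∀ x v, f t x v = g t x v := by
  obtain ⟨r₁, hr₁, hf⟩ := h.density.exists_support
  obtain ⟨r₂, -, hg⟩ := h'.density.exists_support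
  obtain ⟨C, hC, hgv⟩ := h'.density.exists_abs_deriv_velocity_le h.pos
  obtain ⟨A₀, hA₀, hA₀_le⟩ := (h.density.sub h'.density).exists_abs_le
  set r := max r₁ r₂
  have hr : 0 ≤ r := hr₁.le.trans (le_max_left _ _)
  obtain ⟨l, hl_def⟩ : ∃ l, l = 4 * r * C + 1 := ⟨_, rfl⟩
  have hl : 1 ≤ l := hl_def ▸ le_add_of_nonneg_left (by positivity)
  have hl0 : 0 < l := by linarith
  set S : Set ℝ := {A | ∀ t ∈ Icc 0 T, ∀ x v, |f t x v - g t x v| ≤ A * Real.exp (l * t)}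
  have hS : IsClosed S := by
    simp only [S, ofPred_forall]
    exact isClosed_iInter fun t => isClosed_iInter fun _ => isClosed_iInter fun x =>
      isClosed_iInter fun v => isClosed_le continuous_const (by fun_prop)
  have hA₀S : A₀ ∈ S := fun t ht x v => (hA₀_le t ht x v).trans
    (le_mul_of_one_le_right hA₀ (Real.one_le_exp (mul_nonneg hl0.le ht.1)))
  have hlC : 4 * r * C ≤ l * l := by nlinarith
  have hhalf : ∀ A ∈ S, 0 ≤ A → 0 + A / 2 ∈ S := by
    intro A hAS hA t ht x v
    have hfield := h.abs_field_sub_field_le h' hr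
      (fun t ht x v hne => (hf t ht x v hne).2.trans (le_max_left _ _))
      (fun t ht x v hne => (hg t ht x v hne).2.trans (le_max_right _ _)) hl0 hA hAS
    refine (h.abs_density_sub_density_le h' (by positivity) hl0 hC hgv hfield t ht x v).trans ?_
    gcongr
    calc 2 * r * A / l * C / l = (4 * r * C) * A / 2 / (l * l) := by ring
      _ ≤ (l * l) * A / 2 / (l * l) := by gcongr ?_ * A / 2 / (l * l)
      _ = 0 + A / 2 := by rw [zero_add]; field_simp
  have hzero := two_mul_mem_of_add_half_mem hS le_rfl hA₀ hA₀S hhalf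
  intro t ht x v
  simpa [sub_eq_zero] using hzero t ht x v

theorem eq_of_eq_data (h : IsClassicalSolution f₀ B₀ T f B)
    (h' : IsClassicalSolution f₀ B₀ T g D) :
    ∀ t ∈ Icc 0 T, ∀ x : ℝ, (∀ v : ℝ, f t x v = g t x v) ∧ B t x = D t x := by
  have hfg := h.density_eq_of_eq_data h'
  obtain ⟨r, hr, hsupp⟩ := h.density.exists_support
  have hBD := h.abs_field_sub_field_le (A := 0) h' hr.le
    (fun t ht x v hne => (hsupp t ht x v hne).2)
    (fun t ht x v hne => (hsupp t ht x v (hfg t ht x v ▸ hne)).2) one_pos le_rfl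
    (fun t ht x v => by simp [hfg t ht x v])
  exact fun t ht x => ⟨hfg t ht x, by simpa [sub_eq_zero] using hBD t ht x⟩

end Uniqueness

section APriori

variable {M P₀ X₀ P b A l : ℝ}

theorem abs_density_le (h : IsClassicalSolution f₀ B₀ T f B) (hM : ∀ z, |f₀ z| ≤ M) :
    ∀ t ∈ Icc 0 T, ∀ x v, |f t x v| ≤ M :=
  h.density.abs_le_of_abs_transport_le (a := fun _ _ v => v) (b := fun t x _ => B t x)
    (fun t => hasDerivAt_const t M) (fun _ _ => (abs_nonneg _).trans (hM 0))
    (fun x v => by rw [h.init_density]; exact hM _)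
    fun t ht x v => by rw [h.vlasov t ht x v, abs_zero]

/- The function `f² max(a x + b v - p, 0)` is transported with a nonpositive source. -/
theorem support_subset_halfPlane (h : IsClassicalSolution f₀ B₀ T f B) {a b : ℝ} {p p' : ℝ → ℝ}
    (hp : ∀ s, HasDerivAt p (p' s) s) (hinit : ∀ x v, f₀ (x, v) ≠ 0 → a * x + b * v ≤ p 0)
    (hspeed : ∀ t ∈ Icc 0 T, ∀ x v, f t x v ≠ 0 → a * v + b * B t x ≤ p' t) :
    ∀ t ∈ Icc 0 T, ∀ x v, f t x v ≠ 0 → a * x + b * v ≤ p t := by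
  have hpc : Continuous p := continuous_iff_continuousAt.2 fun t => (hp t).continuousAt
  obtain ⟨K, hK, hfK⟩ := h.density.2
  have key := nonpos_of_transport_le (T := T) hK
    (w := fun t x v => f t x v ^ 2 * max (a * x + b * v - p t) 0)
    ((h.density.continuousOn.pow 2).mul (by fun_prop))
    (fun t ht x v hxv => by simp [hfK t ht x v hxv]) (fun x v => ?_) (fun t ht x v hpos => ?_)
  · intro t ht x v hne
    by_contra! hlt
    exact (key t ht x v).not_gt (mul_pos (by positivity) (lt_max_of_lt_left (sub_pos.2 hlt)))
  · rw [h.init_density]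
    by_cases hne : f₀ (x, v) = 0
    · simp [hne]
    · simp [max_eq_right (sub_nonpos.2 (hinit x v hne))]
  · have hne : f t x v ≠ 0 := fun h0 => by simp [h0] at hpos
    have hs : 0 < a * x + b * v - p t := by
      by_contra! hle
      simp [max_eq_right hle] at hpos
    have hsx : ∀ᶠ y in 𝓝 x, 0 < a * y + b * v - p t :=
      continuousAt_const.eventually_lt (by fun_prop) hs
    have hsv : ∀ᶠ u in 𝓝 v, 0 < a * x + b * u - p t :=
      continuousAt_const.eventually_lt (by fun_prop) hs
    have hst : ∀ᶠ s in 𝓝 t, 0 < a * x + b * v - p s :=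
      continuousAt_const.eventually_lt (by fun_prop) hs
    refine ⟨v, B t x, _, _, _,
      (((h.density.hasDerivWithinAt_time ht x v).pow 2).mul
        ((hp t).const_sub (a * x + b * v)).hasDerivWithinAt).congr_of_eventuallyEq
        (hst.filter_mono nhdsWithin_le_nhds |>.mono fun s hs => ?_) ?_,
      (((h.density.hasDerivAt_position ht x v).pow 2).mul
        (((hasDerivAt_const_mul a).add_const (b * v)).sub_const (p t))).congr_of_eventuallyEq
        (hsx.mono fun y hs => ?_),
      (((h.density.hasDerivAt_velocity ht x v).pow 2).mul
        (((hasDerivAt_const_mul b).const_add (a * x)).sub_const (p t))).congr_of_eventuallyEq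
        (hsv.mono fun u hs => ?_), ?_⟩
    all_goals try simp only [Pi.mul_apply, Pi.pow_apply, max_eq_left hs.le]
    have hsource : f t x v ^ 2 * (a * v + b * B t x - p' t) ≤ 0 :=
      mul_nonpos_of_nonneg_of_nonpos (sq_nonneg _) (sub_nonpos.2 (hspeed t ht x v hne))
    refine le_of_eq_of_le ?_ hsource
    push_cast
    linear_combination 2 * f t x v * (a * x + b * v - p t) * h.vlasov t ht x v

theorem support_subset_strip (h : IsClassicalSolution f₀ B₀ T f B) {a b : ℝ} {p p' : ℝ → ℝ}
    (hp : ∀ s, HasDerivAt p (p' s) s) (hinit : ∀ x v, f₀ (x, v) ≠ 0 → |a * x + b * v| ≤ p 0)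
    (hspeed : ∀ t ∈ Icc 0 T, ∀ x v, f t x v ≠ 0 → |a * v + b * B t x| ≤ p' t) :
    ∀ t ∈ Icc 0 T, ∀ x v, f t x v ≠ 0 → |a * x + b * v| ≤ p t := by
  refine fun t ht x v hne => abs_le'.2 ⟨?_, ?_⟩
  · exact h.support_subset_halfPlane hp (fun x v hne => (le_abs_self _).trans (hinit x v hne))
      (fun t ht x v hne => (le_abs_self _).trans (hspeed t ht x v hne)) t ht x v hne
  · have := h.support_subset_halfPlane (a := -a) (b := -b) hp
      (fun x v hne => by linarith [neg_le_abs (a * x + b * v), hinit x v hne])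
      (fun t ht x v hne => by linarith [neg_le_abs (a * v + b * B t x), hspeed t ht x v hne])
      t ht x v hne
    linarith

theorem abs_field_sub_le (h : IsClassicalSolution f₀ B₀ T f B) {β β' : ℝ → ℝ}
    (hβ : ∀ s, HasDerivAt β (β' s) s) (hb : ∀ s ∈ Icc 0 T, ∀ x, |∫ v, f s x v| ≤ β' s) :
    ∀ t ∈ Icc 0 T, ∀ x, |B t x - B₀ (x - t)| ≤ β t - β 0 := by
  intro t ht x
  simpa [h.init_field] using abs_sub_le_of_abs_deriv_le (u := fun s => B s (x - t + s))
    (fun s hs => h.hasDerivWithinAt_field_line hs (x - t)) hβ (fun s hs => hb s hs _) ht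

theorem abs_velocity_le_of_abs_velocity_le (h : IsClassicalSolution f₀ B₀ T f B)
    (hM : ∀ z, |f₀ z| ≤ M) (hf₀ : ∀ x v, f₀ (x, v) ≠ 0 → |v| ≤ P₀) (hb : ∀ x, |B₀ x| ≤ b)
    (hl : 0 < l) (hA : 0 ≤ A)
    (hA_le : ∀ t ∈ Icc 0 T, ∀ x v, f t x v ≠ 0 → |v| ≤ A * Real.exp (l * t)) :
    ∀ t ∈ Icc 0 T, ∀ x v, f t x v ≠ 0 →
      |v| ≤ P₀ + b * t + 2 * A * M / l / l * Real.exp (l * t) := by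
  have hM0 : 0 ≤ M := (abs_nonneg _).trans (hM 0)
  have hfield : ∀ t ∈ Icc 0 T, ∀ x, |B t x| ≤ b + 2 * A * M / l * Real.exp (l * t) := by
    intro t ht x
    have hsub := h.abs_field_sub_le (hasDerivAt_div_mul_exp hl.ne' (2 * A * M))
      (fun s hs x => (abs_integral_le_of_support (by positivity) (hA_le s hs x)
        (h.abs_density_le hM s hs x)).trans (le_of_eq (by ring))) t ht x
    have : 0 ≤ 2 * A * M / l * Real.exp (l * 0) := by positivity
    linarith [hb (x - t), abs_sub_abs_le_abs_sub (B t x) (B₀ (x - t))]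
  have hstrip := h.support_subset_strip (a := 0) (b := 1)
    (p := fun t => P₀ + b * t + 2 * A * M / l / l * Real.exp (l * t))
    (p' := fun t => b + 2 * A * M / l * Real.exp (l * t))
    (fun s => ((hasDerivAt_const_mul b).const_add P₀).add (hasDerivAt_div_mul_exp hl.ne' _ s))
    (fun x v hne => ?_) (fun t ht x v _ => by simpa using hfield t ht x)
  · simpa using hstrip
  · have : 0 ≤ 2 * A * M / l / l := by positivity
    simpa using (hf₀ x v hne).trans (le_add_of_nonneg_right this)

/- Velocities bounded by `A e^{lt}` bound the field, hence the velocities by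
`(P₀ + b T + A / 2) e^{lt}` when `l` is large enough. -/
theorem abs_velocity_le (h : IsClassicalSolution f₀ B₀ T f B) (hM : ∀ z, |f₀ z| ≤ M)
    (hP₀ : 0 ≤ P₀) (hf₀ : ∀ x v, f₀ (x, v) ≠ 0 → |v| ≤ P₀) (hb : ∀ x, |B₀ x| ≤ b) :
    ∀ t ∈ Icc 0 T, ∀ x v, f t x v ≠ 0 →
      |v| ≤ 2 * (P₀ + b * T) * Real.exp ((4 * M + 1) * T) := by
  have hM0 : 0 ≤ M := (abs_nonneg _).trans (hM 0)
  have hb0 : 0 ≤ b := (abs_nonneg _).trans (hb 0)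
  have hT := h.pos
  set l := 4 * M + 1 with hl_def
  have hl0 : 0 < l := by positivity
  have hexp : ∀ t ∈ Icc 0 T, 1 ≤ Real.exp (l * t) := fun t ht =>
    Real.one_le_exp (mul_nonneg hl0.le ht.1)
  set S : Set ℝ := {A | ∀ t ∈ Icc 0 T, ∀ x v, f t x v ≠ 0 → |v| ≤ A * Real.exp (l * t)}
  have hS : IsClosed S := by
    simp only [S, ofPred_forall]
    exact isClosed_iInter fun t => isClosed_iInter fun _ => isClosed_iInter fun x =>
      isClosed_iInter fun v => isClosed_iInter fun _ => isClosed_le continuous_const (by fun_prop)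
  obtain ⟨r, hr, hsupp⟩ := h.density.exists_support
  have hrS : r ∈ S := fun t ht x v hne => (hsupp t ht x v hne).2.trans
    (le_mul_of_one_le_right hr.le (hexp t ht))
  have hhalf : ∀ A ∈ S, 0 ≤ A → P₀ + b * T + A / 2 ∈ S := by
    intro A hAS hA t ht x v hne
    have hgain : 2 * A * M / l / l ≤ A / 2 := by
      rw [div_div, div_le_iff₀ (by positivity)]
      nlinarith [mul_nonneg hA hM0, hl_def]
    calc |v| ≤ P₀ + b * t + 2 * A * M / l / l * Real.exp (l * t) :=
          h.abs_velocity_le_of_abs_velocity_le hM hf₀ hb hl0 hA hAS t ht x v hne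
      _ ≤ (P₀ + b * T) * Real.exp (l * t) + A / 2 * Real.exp (l * t) := by
          gcongr
          exact (by gcongr; exact ht.2 : P₀ + b * t ≤ P₀ + b * T).trans
            (le_mul_of_one_le_right (by positivity) (hexp t ht))
      _ = (P₀ + b * T + A / 2) * Real.exp (l * t) := by ring
  intro t ht x v hne
  refine (two_mul_mem_of_add_half_mem hS (by positivity) hr.le hrS hhalf t ht x v hne).trans ?_
  gcongr
  exact ht.2

theorem abs_position_le (h : IsClassicalSolution f₀ B₀ T f B)
    (hf₀ : ∀ x v, f₀ (x, v) ≠ 0 → |x| ≤ X₀)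
    (hP : ∀ t ∈ Icc 0 T, ∀ x v, f t x v ≠ 0 → |v| ≤ P) :
    ∀ t ∈ Icc 0 T, ∀ x v, f t x v ≠ 0 → |x| ≤ X₀ + P * t := by
  simpa using h.support_subset_strip (a := 1) (b := 0) (p := fun t => X₀ + P * t)
    (p' := fun _ => P) (fun s => (hasDerivAt_const_mul P).const_add X₀)
    (by simpa using hf₀) (by simpa using hP)

end APriori

end IsClassicalSolution

/-- Projection of the real line onto `[-T, T]`. -/
def clamp (T t : ℝ) : ℝ := max (-T) (min T t)

@[fun_prop]
theorem continuous_clamp (T : ℝ) : Continuous (clamp T) := by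
  unfold clamp; fun_prop

theorem clamp_of_abs_le {T t : ℝ} (ht : |t| ≤ T) : clamp T t = t := by
  rw [abs_le] at ht
  rw [clamp, min_eq_right ht.2, max_eq_right ht.1]

theorem abs_clamp_le {T : ℝ} (hT : 0 ≤ T) (t : ℝ) : |clamp T t| ≤ T :=
  abs_le.2 ⟨le_max_left _ _, max_le (by linarith) (min_le_left _ _)⟩

theorem abs_clamp_sub_clamp_le {T : ℝ} (hT : 0 ≤ T) (s t : ℝ) :
    |clamp T s - clamp T t| ≤ 2 * T :=
  (abs_sub _ _).trans (by linarith [abs_clamp_le hT s, abs_clamp_le hT t])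

theorem continuous_integral_clamp {E : Type*} [NormedAddCommGroup E] [NormedSpace ℝ E] {T : ℝ}
    {H : ℝ → ℝ × ℝ × ℝ → E} (hH : Continuous fun p : (ℝ × ℝ × ℝ) × ℝ => H p.2 p.1) :
    Continuous fun p : ℝ × ℝ × ℝ × ℝ => ∫ τ in clamp T p.2.1..clamp T p.1, H τ p.2 := by
  have h : Continuous (Function.uncurry fun (p : ℝ × ℝ × ℝ × ℝ) (τ : ℝ) => H τ p.2) :=
    hH.comp (by fun_prop : Continuous fun q : (ℝ × ℝ × ℝ × ℝ) × ℝ => (q.1.2, q.2))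
  have hi : ∀ p : ℝ × ℝ × ℝ × ℝ, ∀ a b,
      IntervalIntegrable (fun τ => H τ p.2) MeasureTheory.volume a b := fun p a b =>
    (h.comp (by fun_prop : Continuous fun τ : ℝ => (p, τ))).intervalIntegrable _ _
  exact ((intervalIntegral.continuous_parametric_intervalIntegral_of_continuous h
    (by fun_prop)).sub (intervalIntegral.continuous_parametric_intervalIntegral_of_continuous h
    (by fun_prop))).congr fun p =>
      intervalIntegral.integral_interval_sub_left (hi p 0 _) (hi p 0 _)

theorem abs_integral_integral_le {g : ℝ → ℝ → ℝ} {C P T t : ℝ} (hP : 0 ≤ P) (hC : 0 ≤ C)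
    (ht : |t| ≤ T) (hg : ∀ σ w, |g σ w| ≤ C) :
    |∫ σ in (0 : ℝ)..t, ∫ w in -P..P, g σ w| ≤ C * (2 * P) * T := by
  have hinner : ∀ σ, ‖∫ w in -P..P, g σ w‖ ≤ C * (2 * P) := fun σ =>
    (intervalIntegral.norm_integral_le_of_norm_le_const fun w _ => hg σ w).trans_eq
      (by rw [sub_neg_eq_add, ← two_mul, abs_of_nonneg (by positivity)])
  calc |∫ σ in (0 : ℝ)..t, ∫ w in -P..P, g σ w| ≤ C * (2 * P) * |t - 0| :=
        intervalIntegral.norm_integral_le_of_norm_le_const fun σ _ => hinner σ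
    _ ≤ C * (2 * P) * T := by rw [sub_zero]; gcongr

theorem continuous_of_abs_sub_le {E : Type*} [SeminormedAddCommGroup E] {g : E → ℝ} {N : ℝ}
    (h : ∀ x y, |g x - g y| ≤ N * ‖x - y‖) : Continuous g :=
  (LipschitzWith.of_dist_le' (K := N) fun x y => by
    rw [dist_eq_norm, dist_eq_norm]; exact h x y).continuous

/-- The velocity field `(x, v) ↦ (ψ v, B τ x)` of the characteristic equations in which the speed
`v` is replaced by `ψ v`. -/
def force (ψ : ℝ → ℝ) (B : ℝ → ℝ → ℝ) (τ : ℝ) (z : ℝ × ℝ) : ℝ × ℝ := (ψ z.2, B τ z.1)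

/-- The characteristic equations in integrated form, as a map acting on candidates `Z s t z` for the
position at time `s` of the characteristic through `z` at time `t`. All times are clamped to
`[-T, T]`, so that the map is defined on functions on the whole space. -/
noncomputable def flowMap (T : ℝ) (ψ : ℝ → ℝ) (B : ℝ → ℝ → ℝ) (Z : ℝ → ℝ → ℝ × ℝ → ℝ × ℝ)
    (s t : ℝ) (z : ℝ × ℝ) : ℝ × ℝ :=
  z + ∫ τ in clamp T t..clamp T s, force ψ B τ (Z τ t z)

/-- The field equation integrated along lines of speed one, for the density `f₀ ∘ Z 0 t`
transported by `Z`. Velocities are cut off at `P` and times are clamped to `[-T, T]`. -/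
noncomputable def fieldMap (T P : ℝ) (f₀ : ℝ × ℝ → ℝ) (B₀ : ℝ → ℝ)
    (Z : ℝ → ℝ → ℝ × ℝ → ℝ × ℝ) (t x : ℝ) : ℝ :=
  B₀ (x - clamp T t) +
    ∫ σ in (0 : ℝ)..clamp T t, ∫ w in -P..P, f₀ (Z 0 σ (x - clamp T t + σ, w))

section IntegratedEquations

variable {C N K P T : ℝ} {f₀ : ℝ × ℝ → ℝ} {B₀ ψ : ℝ → ℝ} {B B' : ℝ → ℝ → ℝ}
  {Z Z' : ℝ → ℝ → ℝ × ℝ → ℝ × ℝ}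

theorem norm_force_sub_le (hK : 0 ≤ K) (hψ : ∀ v w, |ψ v - ψ w| ≤ K * |v - w|)
    (hB : ∀ t x y, |B t x - B t y| ≤ K * |x - y|) (τ : ℝ) (z z' : ℝ × ℝ) :
    ‖force ψ B τ z - force ψ B τ z'‖ ≤ K * ‖z - z'‖ := by
  refine norm_prod_le_iff.2 ⟨(hψ _ _).trans ?_, (hB _ _ _).trans ?_⟩
  · gcongr; exact norm_snd_le (z - z')
  · gcongr; exact norm_fst_le (z - z')

theorem continuous_force (hψ : Continuous ψ) (hB : Continuous fun p : ℝ × ℝ => B p.1 p.2) :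
    Continuous fun p : ℝ × ℝ × ℝ => force ψ B p.1 p.2 :=
  (hψ.comp (by fun_prop)).prodMk
    (hB.comp (by fun_prop : Continuous fun p : ℝ × ℝ × ℝ => (p.1, p.2.1)))

theorem continuous_force_flow (hψ : Continuous ψ) (hB : Continuous fun p : ℝ × ℝ => B p.1 p.2)
    (hZ : Continuous fun p : ℝ × ℝ × ℝ × ℝ => Z p.1 p.2.1 p.2.2) :
    Continuous fun p : ℝ × ℝ × ℝ × ℝ => force ψ B p.1 (Z p.1 p.2.1 p.2.2) :=
  (continuous_force hψ hB).comp (continuous_fst.prodMk hZ)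

theorem intervalIntegrable_force_flow (hψ : Continuous ψ)
    (hB : Continuous fun p : ℝ × ℝ => B p.1 p.2)
    (hZ : Continuous fun p : ℝ × ℝ × ℝ × ℝ => Z p.1 p.2.1 p.2.2) (t : ℝ) (z : ℝ × ℝ) (a b : ℝ) :
    IntervalIntegrable (fun τ => force ψ B τ (Z τ t z)) MeasureTheory.volume a b :=
  ((continuous_force_flow hψ hB hZ).comp
    (by fun_prop : Continuous fun τ : ℝ => (τ, t, z))).intervalIntegrable _ _

theorem continuous_flowMap (hψ : Continuous ψ) (hB : Continuous fun p : ℝ × ℝ => B p.1 p.2)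
    (hZ : Continuous fun p : ℝ × ℝ × ℝ × ℝ => Z p.1 p.2.1 p.2.2) :
    Continuous fun p : ℝ × ℝ × ℝ × ℝ => flowMap T ψ B Z p.1 p.2.1 p.2.2 :=
  (by fun_prop : Continuous fun p : ℝ × ℝ × ℝ × ℝ => p.2.2).add
    (continuous_integral_clamp (H := fun τ q => force ψ B τ (Z τ q.1 q.2))
      ((continuous_force_flow hψ hB hZ).comp
        (by fun_prop : Continuous fun p : (ℝ × ℝ × ℝ) × ℝ => (p.2, p.1))))

theorem norm_flowMap_sub_le (hT : 0 ≤ T) (hC : 0 ≤ C) {t : ℝ} {z : ℝ × ℝ}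
    (h : ∀ τ, ‖force ψ B τ (Z τ t z)‖ ≤ C) (s : ℝ) :
    ‖flowMap T ψ B Z s t z - z‖ ≤ C * (2 * T) := by
  rw [flowMap, add_sub_cancel_left]
  exact (intervalIntegral.norm_integral_le_of_norm_le_const fun τ _ => h τ).trans
    (mul_le_mul_of_nonneg_left (abs_clamp_sub_clamp_le hT _ _) hC)

theorem norm_flowMap_sub_flowMap_le (hψ : Continuous ψ)
    (hB : Continuous fun p : ℝ × ℝ => B p.1 p.2) (hB' : Continuous fun p : ℝ × ℝ => B' p.1 p.2)
    (hZ : Continuous fun p : ℝ × ℝ × ℝ × ℝ => Z p.1 p.2.1 p.2.2)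
    (hZ' : Continuous fun p : ℝ × ℝ × ℝ × ℝ => Z' p.1 p.2.1 p.2.2) (hT : 0 ≤ T) (hC : 0 ≤ C)
    {t : ℝ} {z z' : ℝ × ℝ}
    (h : ∀ τ, ‖force ψ B τ (Z τ t z) - force ψ B' τ (Z' τ t z')‖ ≤ C) (s : ℝ) :
    ‖flowMap T ψ B Z s t z - flowMap T ψ B' Z' s t z'‖ ≤ ‖z - z'‖ + C * (2 * T) := by
  rw [flowMap, flowMap, add_sub_add_comm, ← intervalIntegral.integral_sub
    (intervalIntegrable_force_flow hψ hB hZ _ _ _ _)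
    (intervalIntegrable_force_flow hψ hB' hZ' _ _ _ _)]
  refine (norm_add_le _ _).trans (add_le_add_right ?_ _)
  exact (intervalIntegral.norm_integral_le_of_norm_le_const fun τ _ => h τ).trans
    (mul_le_mul_of_nonneg_left (abs_clamp_sub_clamp_le hT _ _) hC)

theorem continuous_density_flow (hf₀ : Continuous f₀)
    (hZ : Continuous fun p : ℝ × ℝ × ℝ × ℝ => Z p.1 p.2.1 p.2.2) :
    Continuous fun p : ℝ × ℝ × ℝ => f₀ (Z 0 p.1 p.2) :=
  hf₀.comp (hZ.comp (by fun_prop : Continuous fun p : ℝ × ℝ × ℝ => ((0 : ℝ), p.1, p.2)))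

theorem continuous_charge (hf₀ : Continuous f₀)
    (hZ : Continuous fun p : ℝ × ℝ × ℝ × ℝ => Z p.1 p.2.1 p.2.2) :
    Continuous fun p : ℝ × ℝ => ∫ w in -P..P, f₀ (Z 0 p.1 (p.2, w)) :=
  intervalIntegral.continuous_parametric_intervalIntegral_of_continuous'
    (f := fun (p : ℝ × ℝ) w => f₀ (Z 0 p.1 (p.2, w)))
    ((continuous_density_flow hf₀ hZ).comp
      (by fun_prop : Continuous fun q : (ℝ × ℝ) × ℝ => (q.1.1, (q.1.2, q.2)))) _ _

theorem continuous_fieldMap (hf₀ : Continuous f₀) (hB₀ : Continuous B₀)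
    (hZ : Continuous fun p : ℝ × ℝ × ℝ × ℝ => Z p.1 p.2.1 p.2.2) :
    Continuous fun p : ℝ × ℝ => fieldMap T P f₀ B₀ Z p.1 p.2 := by
  have hcharge : Continuous (Function.uncurry fun (p : ℝ × ℝ) (σ : ℝ) =>
      ∫ w in -P..P, f₀ (Z 0 σ (p.2 - clamp T p.1 + σ, w))) :=
    (continuous_charge hf₀ hZ).comp
      (by fun_prop : Continuous fun q : (ℝ × ℝ) × ℝ => (q.2, q.1.2 - clamp T q.1.1 + q.2))
  exact (hB₀.comp (by fun_prop)).add
    (intervalIntegral.continuous_parametric_intervalIntegral_of_continuous hcharge (by fun_prop))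

theorem abs_fieldMap_le (hT : 0 ≤ T) (hP : 0 ≤ P) (hf₀ : ∀ z, |f₀ z| ≤ N)
    (hB₀ : ∀ x, |B₀ x| ≤ N) (t x : ℝ) : |fieldMap T P f₀ B₀ Z t x| ≤ N + N * (2 * P) * T :=
  (abs_add_le _ _).trans (add_le_add (hB₀ _) (abs_integral_integral_le hP
    ((abs_nonneg _).trans (hf₀ 0)) (abs_clamp_le hT _) fun _ _ => hf₀ _))

theorem abs_fieldMap_sub_fieldMap_le (hf₀ : Continuous f₀)
    (hZ : Continuous fun p : ℝ × ℝ × ℝ × ℝ => Z p.1 p.2.1 p.2.2)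
    (hZ' : Continuous fun p : ℝ × ℝ × ℝ × ℝ => Z' p.1 p.2.1 p.2.2) (hT : 0 ≤ T) (hP : 0 ≤ P)
    (hC : 0 ≤ C) {t x x' : ℝ} (h : ∀ σ w, |f₀ (Z 0 σ (x - clamp T t + σ, w)) -
      f₀ (Z' 0 σ (x' - clamp T t + σ, w))| ≤ C) :
    |fieldMap T P f₀ B₀ Z t x - fieldMap T P f₀ B₀ Z' t x'| ≤
      |B₀ (x - clamp T t) - B₀ (x' - clamp T t)| + C * (2 * P) * T := by
  have houter : ∀ {Z : ℝ → ℝ → ℝ × ℝ → ℝ × ℝ},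
      (Continuous fun p : ℝ × ℝ × ℝ × ℝ => Z p.1 p.2.1 p.2.2) → ∀ y, IntervalIntegrable
        (fun σ => ∫ w in -P..P, f₀ (Z 0 σ (y + σ, w))) MeasureTheory.volume 0 (clamp T t) :=
    fun hZ y => ((continuous_charge hf₀ hZ).comp
      (by fun_prop : Continuous fun σ : ℝ => (σ, y + σ))).intervalIntegrable _ _
  have hinner : ∀ {Z : ℝ → ℝ → ℝ × ℝ → ℝ × ℝ},
      (Continuous fun p : ℝ × ℝ × ℝ × ℝ => Z p.1 p.2.1 p.2.2) → ∀ y σ, IntervalIntegrable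
        (fun w => f₀ (Z 0 σ (y + σ, w))) MeasureTheory.volume (-P) P :=
    fun hZ y σ => ((continuous_density_flow hf₀ hZ).comp
      (by fun_prop : Continuous fun w : ℝ => (σ, (y + σ, w)))).intervalIntegrable _ _
  rw [fieldMap, fieldMap, add_sub_add_comm,
    ← intervalIntegral.integral_sub (houter hZ _) (houter hZ' _)]
  simp_rw [← intervalIntegral.integral_sub (hinner hZ _ _) (hinner hZ' _ _)]
  exact (abs_add_le _ _).trans
    (add_le_add_right (abs_integral_integral_le hP hC (abs_clamp_le hT t) h) _)

end IntegratedEquations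

/-- Data of the truncated problem: the velocities entering the field equation are cut off at `P`,
the speed `v` in the characteristic equations is replaced by a bounded function `ψ v`, and all data
are bounded and Lipschitz with constant `N`, with uniformly continuous derivatives. The time `T` is
so short that the Picard map is a contraction. -/
structure TruncatedData (N P T : ℝ) (f₀ : ℝ × ℝ → ℝ) (B₀ ψ : ℝ → ℝ) : Prop where
  one_le : 1 ≤ N
  cutoff_nonneg : 0 ≤ P
  cutoff_le : P ≤ N
  time_pos : 0 < T
  time_mul_sq_le : T * (N + 1) ^ 2 ≤ 1 / 24
  abs_density₀_le : ∀ z, |f₀ z| ≤ N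
  density₀_lip : ∀ z z', |f₀ z - f₀ z'| ≤ N * ‖z - z'‖
  uniformC1_density₀ : UniformC1 fun _ : Unit => f₀
  abs_field₀_le : ∀ x, |B₀ x| ≤ N
  field₀_lip : ∀ x y, |B₀ x - B₀ y| ≤ N * |x - y|
  uniformC1_field₀ : UniformC1 fun _ : Unit => B₀
  abs_speed_le : ∀ v, |ψ v| ≤ N
  speed_lip : ∀ v w, |ψ v - ψ w| ≤ N * |v - w|
  uniformC1_speed : UniformC1 fun _ : Unit => ψ

namespace TruncatedData

variable {N P T : ℝ} {f₀ : ℝ × ℝ → ℝ} {B₀ ψ : ℝ → ℝ}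

theorem nonneg (D : TruncatedData N P T f₀ B₀ ψ) : 0 ≤ N := zero_le_one.trans D.one_le

theorem time_mul_le (D : TruncatedData N P T f₀ B₀ ψ) : T * (N + 1) ≤ 1 / 48 := by
  nlinarith [D.time_mul_sq_le, mul_nonneg D.time_pos.le (by linarith [D.nonneg] : 0 ≤ N + 1),
    D.one_le]

theorem mul_time_le (D : TruncatedData N P T f₀ B₀ ψ) : N * P * T ≤ 1 / 24 := by
  have hNP : N * P ≤ (N + 1) ^ 2 := by
    nlinarith [D.nonneg, mul_le_mul_of_nonneg_left D.cutoff_le D.nonneg]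
  calc N * P * T ≤ (N + 1) ^ 2 * T := mul_le_mul_of_nonneg_right hNP D.time_pos.le
    _ ≤ 1 / 24 := by rw [mul_comm]; exact D.time_mul_sq_le

theorem continuous_density₀ (D : TruncatedData N P T f₀ B₀ ψ) : Continuous f₀ :=
  continuous_of_abs_sub_le D.density₀_lip

theorem continuous_field₀ (D : TruncatedData N P T f₀ B₀ ψ) : Continuous B₀ :=
  continuous_of_abs_sub_le D.field₀_lip

theorem continuous_speed (D : TruncatedData N P T f₀ B₀ ψ) : Continuous ψ :=
  continuous_of_abs_sub_le D.speed_lip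

theorem norm_force_sub_le (D : TruncatedData N P T f₀ B₀ ψ) {B : ℝ → ℝ → ℝ}
    (hB : ∀ t x y, |B t x - B t y| ≤ (N + 1) * |x - y|) (τ : ℝ) (z z' : ℝ × ℝ) :
    ‖force ψ B τ z - force ψ B τ z'‖ ≤ (N + 1) * ‖z - z'‖ :=
  VlasovField.norm_force_sub_le (by linarith [D.nonneg]) (fun v w => (D.speed_lip v w).trans
    (by gcongr; linarith)) hB τ z z'

end TruncatedData

/-- `Z s t` is the flow of `(ψ v, B)` from time `t` to time `s`, and `B` is the field generated by
the density transported by that flow, both equations being understood in integrated form. -/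
structure IsTruncatedSolution (N P T : ℝ) (f₀ : ℝ × ℝ → ℝ) (B₀ ψ : ℝ → ℝ)
    (Z : ℝ → ℝ → ℝ × ℝ → ℝ × ℝ) (B : ℝ → ℝ → ℝ) : Prop
    extends TruncatedData N P T f₀ B₀ ψ where
  continuous_flow : Continuous fun p : ℝ × ℝ × ℝ × ℝ => Z p.1 p.2.1 p.2.2
  continuous_field : Continuous fun p : ℝ × ℝ => B p.1 p.2
  flow_lip : ∀ s t z z', ‖Z s t z - Z s t z'‖ ≤ 2 * ‖z - z'‖
  field_lip : ∀ t x y, |B t x - B t y| ≤ (N + 1) * |x - y|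
  flow_eq : ∀ s t z, Z s t z = flowMap T ψ B Z s t z
  field_eq : ∀ t x, B t x = fieldMap T P f₀ B₀ Z t x

section Picard

open BoundedContinuousFunction

variable {N P T : ℝ} {f₀ : ℝ × ℝ → ℝ} {B₀ ψ : ℝ → ℝ}

/-- Pairs of a displacement `Z s t z - z` along characteristics and a field. -/
abbrev PicardSpace := ((ℝ × ℝ × ℝ × ℝ) →ᵇ (ℝ × ℝ)) × ((ℝ × ℝ) →ᵇ ℝ)

namespace PicardSpace

/-- The flow with the displacement `u.1`. -/
def flow (u : PicardSpace) (s t : ℝ) (z : ℝ × ℝ) : ℝ × ℝ := z + u.1 (s, t, z)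

/-- The field component of `u`, in curried form. -/
def field (u : PicardSpace) (t x : ℝ) : ℝ := u.2 (t, x)

theorem continuous_flow (u : PicardSpace) :
    Continuous fun p : ℝ × ℝ × ℝ × ℝ => u.flow p.1 p.2.1 p.2.2 := by
  unfold flow; fun_prop

theorem continuous_field (u : PicardSpace) : Continuous fun p : ℝ × ℝ => u.field p.1 p.2 := by
  unfold field; fun_prop

theorem dist_le_iff {u u' : PicardSpace} {c : ℝ} (hc : 0 ≤ c) :
    dist u u' ≤ c ↔ (∀ s t z, ‖u.flow s t z - u'.flow s t z‖ ≤ c) ∧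
      ∀ t x, |u.field t x - u'.field t x| ≤ c := by
  rw [Prod.dist_eq, max_le_iff, BoundedContinuousFunction.dist_le hc,
    BoundedContinuousFunction.dist_le hc]
  simp only [Prod.forall, dist_eq_norm, flow, field, add_sub_add_left_eq_sub, ← Real.norm_eq_abs]

/-- Pairs of a flow and a field that are Lipschitz in space, with constants `2` and `K`. -/
def lipschitzPairs (K : ℝ) : Set PicardSpace :=
  {u | (∀ s t z z', ‖u.flow s t z - u.flow s t z'‖ ≤ 2 * ‖z - z'‖) ∧
    ∀ t x y, |u.field t x - u.field t y| ≤ K * |x - y|}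

theorem isClosed_lipschitzPairs (K : ℝ) : IsClosed (lipschitzPairs K) := by
  have hflow : ∀ s t z, Continuous fun u : PicardSpace => u.flow s t z := fun s t z =>
    continuous_const.add ((continuous_eval_const (s, t, z)).comp continuous_fst)
  have hfield : ∀ t x, Continuous fun u : PicardSpace => u.field t x := fun t x =>
    (continuous_eval_const (t, x)).comp continuous_snd
  simp only [lipschitzPairs, ofPred_and, ofPred_forall]
  refine IsClosed.inter ?_ ?_
  · exact isClosed_iInter fun s => isClosed_iInter fun t => isClosed_iInter fun z =>
      isClosed_iInter fun z' =>
        isClosed_le ((hflow s t z).sub (hflow s t z')).norm continuous_const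
  · exact isClosed_iInter fun t => isClosed_iInter fun x => isClosed_iInter fun y =>
      isClosed_le ((hfield t x).sub (hfield t y)).abs continuous_const

theorem zero_mem_lipschitzPairs {K : ℝ} (hK : 0 ≤ K) : (0 : PicardSpace) ∈ lipschitzPairs K := by
  refine ⟨fun s t z z' => ?_, fun t x y => ?_⟩
  · simpa [flow] using le_mul_of_one_le_left (norm_nonneg (z - z')) one_le_two
  · simpa [field] using mul_nonneg hK (abs_nonneg (x - y))

end PicardSpace

open PicardSpace

namespace TruncatedData

/-- The Picard map of the truncated problem; its Lipschitz fixed points are the solutions. -/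
noncomputable def picard (D : TruncatedData N P T f₀ B₀ ψ) (u : PicardSpace) : PicardSpace :=
  (BoundedContinuousFunction.ofNormedAddCommGroup
    (fun p => flowMap T ψ u.field u.flow p.1 p.2.1 p.2.2 - p.2.2)
    ((continuous_flowMap D.continuous_speed u.continuous_field u.continuous_flow).sub
      (by fun_prop))
    (max N ‖u.2‖ * (2 * T))
    fun p => norm_flowMap_sub_le D.time_pos.le (D.nonneg.trans (le_max_left _ _))
      (fun _ => norm_prod_le_iff.2 ⟨(D.abs_speed_le _).trans (le_max_left _ _),
        (u.2.norm_coe_le_norm _).trans (le_max_right _ _)⟩) p.1,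
  BoundedContinuousFunction.ofNormedAddCommGroup
    (fun p => fieldMap T P f₀ B₀ u.flow p.1 p.2)
    (continuous_fieldMap D.continuous_density₀ D.continuous_field₀ u.continuous_flow)
    (N + N * (2 * P) * T)
    fun p => abs_fieldMap_le D.time_pos.le D.cutoff_nonneg D.abs_density₀_le D.abs_field₀_le
      p.1 p.2)

theorem flow_picard (D : TruncatedData N P T f₀ B₀ ψ) (u : PicardSpace) (s t : ℝ) (z : ℝ × ℝ) :
    (D.picard u).flow s t z = flowMap T ψ u.field u.flow s t z :=
  add_sub_cancel z _

theorem field_picard (D : TruncatedData N P T f₀ B₀ ψ) (u : PicardSpace) (t x : ℝ) :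
    (D.picard u).field t x = fieldMap T P f₀ B₀ u.flow t x := rfl

theorem picard_mapsTo (D : TruncatedData N P T f₀ B₀ ψ) :
    MapsTo D.picard (lipschitzPairs (N + 1)) (lipschitzPairs (N + 1)) := by
  rintro u ⟨hflow, hfield⟩
  have hN := D.nonneg
  have hN1 : 0 ≤ N + 1 := by linarith
  refine ⟨fun s t z z' => ?_, fun t x y => ?_⟩
  · rw [D.flow_picard, D.flow_picard]
    calc ‖flowMap T ψ u.field u.flow s t z - flowMap T ψ u.field u.flow s t z'‖
        ≤ ‖z - z'‖ + (N + 1) * (2 * ‖z - z'‖) * (2 * T) :=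
          norm_flowMap_sub_flowMap_le D.continuous_speed u.continuous_field u.continuous_field
            u.continuous_flow u.continuous_flow D.time_pos.le (by positivity)
            (fun τ => (D.norm_force_sub_le hfield τ _ _).trans
              (mul_le_mul_of_nonneg_left (hflow τ t z z') hN1)) s
      _ = ‖z - z'‖ + 4 * (T * (N + 1)) * ‖z - z'‖ := by ring
      _ ≤ 2 * ‖z - z'‖ := by nlinarith [D.time_mul_le, norm_nonneg (z - z')]
  · rw [D.field_picard, D.field_picard]
    have hdensity : ∀ σ w, |f₀ (u.flow 0 σ (x - clamp T t + σ, w)) -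
        f₀ (u.flow 0 σ (y - clamp T t + σ, w))| ≤ N * (2 * |x - y|) := fun σ w => by
      refine (D.density₀_lip _ _).trans (mul_le_mul_of_nonneg_left ((hflow _ _ _ _).trans_eq ?_) hN)
      simp [Prod.norm_def]
    calc |fieldMap T P f₀ B₀ u.flow t x - fieldMap T P f₀ B₀ u.flow t y|
        ≤ |B₀ (x - clamp T t) - B₀ (y - clamp T t)| + N * (2 * |x - y|) * (2 * P) * T :=
          abs_fieldMap_sub_fieldMap_le D.continuous_density₀ u.continuous_flow u.continuous_flow
            D.time_pos.le D.cutoff_nonneg (by positivity) hdensity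
      _ ≤ N * |x - y| + 4 * (N * P * T) * |x - y| := by
          refine add_le_add ((D.field₀_lip _ _).trans_eq ?_) (le_of_eq (by ring))
          rw [sub_sub_sub_cancel_right]
      _ ≤ (N + 1) * |x - y| := by nlinarith [D.mul_time_le, abs_nonneg (x - y)]

theorem dist_picard_le (D : TruncatedData N P T f₀ B₀ ψ) {u u' : PicardSpace}
    (hu : u ∈ lipschitzPairs (N + 1)) :
    dist (D.picard u) (D.picard u') ≤ 1 / 2 * dist u u' := by
  have hN := D.nonneg
  have hN1 : 0 ≤ N + 1 := by linarith
  have hd : 0 ≤ dist u u' := dist_nonneg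
  obtain ⟨hflow, hfield⟩ := (dist_le_iff hd).1 le_rfl
  refine (dist_le_iff (by positivity)).2 ⟨fun s t z => ?_, fun t x => ?_⟩
  · have hforce : ∀ τ, ‖force ψ u.field τ (u.flow τ t z) - force ψ u'.field τ (u'.flow τ t z)‖ ≤
        (N + 1) * dist u u' + dist u u' := fun τ => by
      refine (norm_sub_le_norm_sub_add_norm_sub _ (force ψ u.field τ (u'.flow τ t z)) _).trans
        (add_le_add ((D.norm_force_sub_le hu.2 _ _ _).trans
          (mul_le_mul_of_nonneg_left (hflow τ t z) hN1)) (norm_prod_le_iff.2 ⟨?_, hfield _ _⟩))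
      simp [force, hd]
    rw [D.flow_picard, D.flow_picard]
    calc ‖flowMap T ψ u.field u.flow s t z - flowMap T ψ u'.field u'.flow s t z‖
        ≤ ‖z - z‖ + ((N + 1) * dist u u' + dist u u') * (2 * T) :=
          norm_flowMap_sub_flowMap_le D.continuous_speed u.continuous_field u'.continuous_field
            u.continuous_flow u'.continuous_flow D.time_pos.le (by positivity) hforce s
      _ = (2 * (T * (N + 1)) + 2 * T) * dist u u' := by rw [sub_self, norm_zero]; ring
      _ ≤ 1 / 2 * dist u u' := by
          gcongr
          nlinarith [D.time_mul_le, D.time_pos, D.one_le]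
  · rw [D.field_picard, D.field_picard]
    calc |fieldMap T P f₀ B₀ u.flow t x - fieldMap T P f₀ B₀ u'.flow t x|
        ≤ |B₀ (x - clamp T t) - B₀ (x - clamp T t)| + N * dist u u' * (2 * P) * T :=
          abs_fieldMap_sub_fieldMap_le D.continuous_density₀ u.continuous_flow u'.continuous_flow
            D.time_pos.le D.cutoff_nonneg (by positivity) fun σ w =>
              (D.density₀_lip _ _).trans (mul_le_mul_of_nonneg_left (hflow _ _ _) hN)
      _ = 2 * (N * P * T) * dist u u' := by rw [sub_self, abs_zero]; ring
      _ ≤ 1 / 2 * dist u u' := by nlinarith [D.mul_time_le]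

theorem exists_isTruncatedSolution (D : TruncatedData N P T f₀ B₀ ψ) :
    ∃ Z B, IsTruncatedSolution N P T f₀ B₀ ψ Z B := by
  have hc : ContractingWith (1 / 2) (D.picard_mapsTo.restrict D.picard _ _) := by
    refine ⟨by rw [← NNReal.coe_lt_coe]; norm_num, LipschitzWith.of_dist_le_mul ?_⟩
    rintro ⟨u, hu⟩ ⟨u', -⟩
    push_cast
    exact D.dist_picard_le hu
  obtain ⟨u, hu, hfix, -⟩ := hc.exists_fixedPoint' (isClosed_lipschitzPairs (N + 1)).isComplete
    D.picard_mapsTo (zero_mem_lipschitzPairs (by linarith [D.nonneg])) (edist_ne_top _ _)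
  exact ⟨u.flow, u.field, D, u.continuous_flow, u.continuous_field, hu.1, hu.2,
    fun s t z => by rw [← D.flow_picard, hfix], fun t x => by rw [← D.field_picard, hfix]⟩

end TruncatedData

end Picard

namespace IsTruncatedSolution

variable {N P T : ℝ} {f₀ : ℝ × ℝ → ℝ} {B₀ ψ : ℝ → ℝ} {Z : ℝ → ℝ → ℝ × ℝ → ℝ × ℝ} {B : ℝ → ℝ → ℝ}

theorem abs_field_le (S : IsTruncatedSolution N P T f₀ B₀ ψ Z B) (t x : ℝ) : |B t x| ≤ N + 1 := by
  rw [S.field_eq]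
  linarith [abs_fieldMap_le (Z := Z) S.time_pos.le S.cutoff_nonneg S.abs_density₀_le
    S.abs_field₀_le t x, S.mul_time_le]

theorem norm_flow_sub_le (S : IsTruncatedSolution N P T f₀ B₀ ψ Z B) (s t : ℝ) (z : ℝ × ℝ) :
    ‖Z s t z - z‖ ≤ 1 := by
  rw [S.flow_eq]
  have hforce : ∀ τ, ‖force ψ B τ (Z τ t z)‖ ≤ N + 1 := fun τ =>
    norm_prod_le_iff.2 ⟨(S.abs_speed_le _).trans (by linarith), S.abs_field_le _ _⟩
  linarith [norm_flowMap_sub_le S.time_pos.le (by linarith [S.nonneg]) hforce s, S.time_mul_le]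

theorem continuous_force_flow (S : IsTruncatedSolution N P T f₀ B₀ ψ Z B) :
    Continuous fun p : ℝ × ℝ × ℝ × ℝ => force ψ B p.1 (Z p.1 p.2.1 p.2.2) :=
  VlasovField.continuous_force_flow S.continuous_speed S.continuous_field S.continuous_flow

theorem flow_self (S : IsTruncatedSolution N P T f₀ B₀ ψ Z B) (t : ℝ) (z : ℝ × ℝ) :
    Z t t z = z := by
  rw [S.flow_eq, flowMap, intervalIntegral.integral_same, add_zero]

theorem flow_sub_flow_eq_integral (S : IsTruncatedSolution N P T f₀ B₀ ψ Z B) (r s t : ℝ)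
    (z : ℝ × ℝ) : Z r s (Z s t z) - Z r t z = ∫ σ in clamp T s..clamp T r,
      (force ψ B σ (Z σ s (Z s t z)) - force ψ B σ (Z σ t z)) := by
  have hi := intervalIntegrable_force_flow S.continuous_speed S.continuous_field S.continuous_flow
  rw [intervalIntegral.integral_sub (hi _ _ _ _) (hi _ _ _ _),
    ← intervalIntegral.integral_interval_sub_left (hi t z (clamp T t) _) (hi t z (clamp T t) _)]
  generalize hy : Z s t z = y
  rw [S.flow_eq r s y, S.flow_eq r t z, flowMap, flowMap, ← hy, S.flow_eq s t z, flowMap]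
  abel

/- Both sides solve the same integral equation, so a bound `A` for their distance improves to
`A / 2`. -/
theorem flow_flow (S : IsTruncatedSolution N P T f₀ B₀ ψ Z B) (r s t : ℝ) (z : ℝ × ℝ) :
    Z r s (Z s t z) = Z r t z := by
  set y := Z s t z with hy
  set D : Set ℝ := {A | ∀ τ, ‖Z τ s y - Z τ t z‖ ≤ A}
  have hD : IsClosed D := by
    simp only [D, ofPred_forall]
    exact isClosed_iInter fun _ => isClosed_Ici
  have hbound : 1 + ‖y - z‖ + 1 ∈ D := fun τ =>
    calc ‖Z τ s y - Z τ t z‖ = ‖(Z τ s y - y) + (y - z) - (Z τ t z - z)‖ := by congr 1; abel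
      _ ≤ ‖Z τ s y - y‖ + ‖y - z‖ + ‖Z τ t z - z‖ :=
        (norm_sub_le _ _).trans (add_le_add_left (norm_add_le _ _) _)
      _ ≤ 1 + ‖y - z‖ + 1 := by gcongr <;> apply S.norm_flow_sub_le
  have hhalf : ∀ A ∈ D, 0 ≤ A → 0 + A / 2 ∈ D := fun A hAD hA τ => by
    have hforce : ∀ σ, ‖force ψ B σ (Z σ s y) - force ψ B σ (Z σ t z)‖ ≤ (N + 1) * A := fun σ =>
      (S.norm_force_sub_le S.field_lip _ _ _).trans
        (mul_le_mul_of_nonneg_left (hAD σ) (by linarith [S.nonneg]))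
    calc ‖Z τ s y - Z τ t z‖ ≤ (N + 1) * A * |clamp T τ - clamp T s| := by
          rw [hy, S.flow_sub_flow_eq_integral]
          exact intervalIntegral.norm_integral_le_of_norm_le_const fun σ _ => hforce σ
      _ ≤ (N + 1) * A * (2 * T) := mul_le_mul_of_nonneg_left
          (abs_clamp_sub_clamp_le S.time_pos.le _ _) ((norm_nonneg _).trans (hforce 0))
      _ ≤ 0 + A / 2 := by nlinarith [S.time_mul_le]
  have hzero : 2 * 0 ∈ D := two_mul_mem_of_add_half_mem hD le_rfl (by positivity) hbound hhalf
  rw [mul_zero] at hzero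
  exact sub_eq_zero.1 (norm_le_zero_iff.1 (hzero r))

end IsTruncatedSolution

theorem hasDerivAt_integral_left_diag {E : Type*} [NormedAddCommGroup E] [NormedSpace ℝ E]
    [CompleteSpace E] {H : ℝ → ℝ → E} (hH : Continuous fun p : ℝ × ℝ => H p.1 p.2) (t : ℝ) :
    HasDerivAt (fun r => ∫ τ in r..t, H τ r) (-H t t) t := by
  rw [hasDerivAt_iff_isLittleO, Asymptotics.isLittleO_iff]
  intro ε hε
  obtain ⟨δ, hδ, hd⟩ := Metric.continuousAt_iff.1 (hH.continuousAt (x := (t, t))) ε hε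
  filter_upwards [Metric.ball_mem_nhds t hδ] with r hr
  have hclose : ∀ τ ∈ uIoc r t, ‖H τ r - H t t‖ ≤ ε := fun τ hτ => by
    have hτ' : dist τ t < δ := by
      rw [dist_comm, Real.dist_eq]
      refine (abs_sub_right_of_mem_uIcc (uIoc_subset_uIcc hτ)).trans_lt ?_
      rwa [← Real.dist_eq, dist_comm]
    rw [← dist_eq_norm]
    exact (hd (x := (τ, r)) (max_lt hτ' hr)).le
  have hi : IntervalIntegrable (fun τ => H τ r) MeasureTheory.volume r t :=
    (hH.comp (by fun_prop : Continuous fun τ : ℝ => (τ, r))).intervalIntegrable _ _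
  calc ‖(∫ τ in r..t, H τ r) - (∫ τ in t..t, H τ t) - (r - t) • -H t t‖
      = ‖∫ τ in r..t, (H τ r - H t t)‖ := by
        rw [intervalIntegral.integral_sub hi (by simp), intervalIntegral.integral_const,
          intervalIntegral.integral_same, sub_zero, smul_neg, ← neg_smul, neg_sub]
    _ ≤ ε * |t - r| := intervalIntegral.norm_integral_le_of_norm_le_const hclose
    _ = ε * ‖r - t‖ := by rw [abs_sub_comm, Real.norm_eq_abs]

theorem contDiffOn_of_partial {E : Type*} [NormedAddCommGroup E] [NormedSpace ℝ E]
    {F g : ℝ → E → ℝ} {A : ℝ → E → E →L[ℝ] ℝ} {U : Set ℝ} (hU : IsOpen U)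
    (h₁ : ∀ t ∈ U, ∀ z, HasDerivAt (fun s => F s z) (g t z) t)
    (h₂ : ∀ t ∈ U, ∀ z, HasFDerivAt (F t) (A t z) z)
    (hg : Continuous fun p : ℝ × E => g p.1 p.2) (hA : Continuous fun p : ℝ × E => A p.1 p.2) :
    ContDiffOn ℝ 1 (fun p : ℝ × E => F p.1 p.2) (U ×ˢ univ) := by
  have hO : IsOpen (U ×ˢ (univ : Set E)) := hU.prod isOpen_univ
  have hg' : Continuous fun p : ℝ × E => ContinuousLinearMap.toSpanSingleton ℝ (g p.1 p.2) :=
    (ContinuousLinearMap.toSpanSingletonCLE (𝕜 := ℝ) (E := ℝ)).continuous.comp hg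
  have hderiv : ∀ p ∈ U ×ˢ (univ : Set E), HasFDerivAt (fun p : ℝ × E => F p.1 p.2)
      ((ContinuousLinearMap.toSpanSingleton ℝ (g p.1 p.2)).coprod (A p.1 p.2)) p := fun p hp => by
    have hev : ∀ᶠ q in 𝓝 p, q.1 ∈ U := (hO.eventually_mem hp).mono fun q hq => hq.1
    exact (hasStrictFDerivAt_uncurry_coprod (u := p) (f := F)
      (f₁ := fun t z => ContinuousLinearMap.toSpanSingleton ℝ (g t z)) (f₂ := A)
      (hev.mono fun q hq => (h₁ q.1 hq q.2).hasFDerivAt)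
      (hev.mono fun q hq => h₂ q.1 hq q.2) hg'.continuousAt hA.continuousAt).hasFDerivAt
  have hcont : Continuous fun p : ℝ × E =>
      (ContinuousLinearMap.toSpanSingleton ℝ (g p.1 p.2)).coprod (A p.1 p.2) := by
    have hsplit : (fun p : ℝ × E =>
        (ContinuousLinearMap.toSpanSingleton ℝ (g p.1 p.2)).coprod (A p.1 p.2)) = fun p =>
        (ContinuousLinearMap.toSpanSingleton ℝ (g p.1 p.2)).comp
          (ContinuousLinearMap.fst ℝ ℝ E) + (A p.1 p.2).comp (ContinuousLinearMap.snd ℝ ℝ E) := by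
      funext p
      ext <;> simp
    rw [hsplit]
    exact (hg'.clm_comp continuous_const).add (hA.clm_comp continuous_const)
  rw [show (1 : WithTop ℕ∞) = 0 + 1 by simp, contDiffOn_succ_iff_fderiv_of_isOpen hO]
  refine ⟨fun p hp => (hderiv p hp).differentiableAt.differentiableWithinAt, by simp, ?_⟩
  rw [contDiffOn_zero]
  exact hcont.continuousOn.congr fun p hp => (hderiv p hp).fderiv

namespace IsTruncatedSolution

variable {N P T : ℝ} {f₀ : ℝ × ℝ → ℝ} {B₀ ψ : ℝ → ℝ} {Z : ℝ → ℝ → ℝ × ℝ → ℝ × ℝ} {B : ℝ → ℝ → ℝ}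
  {ε t : ℝ}

theorem incrementOscLE_flow_half (S : IsTruncatedSolution N P T f₀ B₀ ψ Z B) (hε : 0 < ε)
    (hZ : IncrementOscLE ε fun (p : ℝ × ℝ) z => Z p.1 p.2 z) (hB : IncrementOscLE ε B) :
    IncrementOscLE (ε / 2) fun (p : ℝ × ℝ) z => Z p.1 p.2 z := by
  have hN := S.nonneg
  have hforce : IncrementOscLE ε (force ψ B) :=
    (((S.uniformC1_speed ε hε).reindex fun _ : ℝ => ()).comp_affine hε.le norm_snd_le
      fun _ _ _ => rfl).prodMk (hB.comp_affine hε.le norm_fst_le fun _ _ _ => rfl)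
  have hforce_flow : IncrementOscLE (2 * ε + (N + 1) * ε)
      fun (k : (ℝ × ℝ) × ℝ) z => force ψ B k.2 (Z k.2 k.1.2 z) :=
    (hforce.reindex fun k : (ℝ × ℝ) × ℝ => k.2).comp hε.le (by linarith)
      (fun _ => S.norm_force_sub_le S.field_lip _) (hZ.reindex fun k : (ℝ × ℝ) × ℝ => (k.2, k.1.2))
      zero_le_two fun _ => S.flow_lip _ _
  have hintegral : IncrementOscLE (2 * T * (2 * ε + (N + 1) * ε)) fun (p : ℝ × ℝ) z =>
      ∫ τ in clamp T p.2..clamp T p.1, force ψ B τ (Z τ p.2 z) :=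
    .intervalIntegral (H := fun (p : ℝ × ℝ) τ z => force ψ B τ (Z τ p.2 z)) (by positivity)
      hforce_flow
      (fun (p : ℝ × ℝ) z => S.continuous_force_flow.comp
        (by fun_prop : Continuous fun τ : ℝ => (τ, p.2, z)))
      fun p => abs_clamp_sub_clamp_le S.time_pos.le _ _
  have hid : IncrementOscLE 0 fun (_ : ℝ × ℝ) (z : ℝ × ℝ) => z :=
    ⟨1, one_pos, fun i z z' h _ _ => by simp⟩
  have hsum := hid.add hintegral
  rw [show (fun (p : ℝ × ℝ) z => Z p.1 p.2 z) = fun p z => flowMap T ψ B Z p.1 p.2 z by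
    funext p z; exact S.flow_eq _ _ _]
  refine hsum.mono ?_
  have hT : T ≤ 1 / 48 := by nlinarith [S.time_mul_le, S.time_pos]
  calc 0 + 2 * T * (2 * ε + (N + 1) * ε) = (4 * T + 2 * (T * (N + 1))) * ε := by ring
    _ ≤ ε / 2 := by nlinarith [S.time_mul_le]

theorem incrementOscLE_field_half (S : IsTruncatedSolution N P T f₀ B₀ ψ Z B) (hε : 0 < ε)
    (hZ : IncrementOscLE ε fun (p : ℝ × ℝ) z => Z p.1 p.2 z) : IncrementOscLE (ε / 2) B := by
  have hN := S.nonneg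
  have hP := S.cutoff_nonneg
  have hdensity : IncrementOscLE (2 * ε + N * ε) fun (σ : ℝ) z => f₀ (Z 0 σ z) :=
    ((S.uniformC1_density₀ ε hε).reindex fun _ => ()).comp hε.le hN (fun _ => S.density₀_lip)
      (hZ.reindex fun σ => (0, σ)) zero_le_two fun _ => S.flow_lip _ _
  have hslice : IncrementOscLE (2 * ε + N * ε) fun (k : (ℝ × ℝ) × ℝ) (x : ℝ) =>
      f₀ (Z 0 k.1.2 (x - clamp T k.1.1 + k.1.2, k.2)) :=
    (hdensity.reindex fun k : (ℝ × ℝ) × ℝ => k.1.2).comp_affine (by positivity)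
      (A := fun x => (x, 0)) (fun x => by simp [Prod.norm_def])
      fun k x y => by ext <;> simp; ring
  have hdensity_flow := continuous_density_flow S.continuous_density₀ S.continuous_flow
  have hcharge : IncrementOscLE (2 * P * (2 * ε + N * ε)) fun (k : ℝ × ℝ) x =>
      ∫ w in -P..P, f₀ (Z 0 k.2 (x - clamp T k.1 + k.2, w)) :=
    .intervalIntegral (H := fun (k : ℝ × ℝ) w x => f₀ (Z 0 k.2 (x - clamp T k.1 + k.2, w)))
      (by positivity) hslice
      (fun (k : ℝ × ℝ) x => hdensity_flow.comp
        (by fun_prop : Continuous fun w : ℝ => (k.2, (x - clamp T k.1 + k.2, w))))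
      fun _ => by rw [sub_neg_eq_add, ← two_mul, abs_of_nonneg (by positivity)]
  have hintegral : IncrementOscLE (T * (2 * P * (2 * ε + N * ε))) fun t x =>
      ∫ σ in (0 : ℝ)..clamp T t, ∫ w in -P..P, f₀ (Z 0 σ (x - clamp T t + σ, w)) :=
    .intervalIntegral (H := fun t σ x => ∫ w in -P..P, f₀ (Z 0 σ (x - clamp T t + σ, w)))
      (by positivity) hcharge
      (fun t x => (continuous_charge S.continuous_density₀ S.continuous_flow).comp
        (by fun_prop : Continuous fun σ : ℝ => (σ, x - clamp T t + σ)))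
      fun t => by rw [sub_zero]; exact abs_clamp_le S.time_pos.le t
  have hinit : IncrementOscLE (ε / 4) fun t x => B₀ (x - clamp T t) :=
    ((S.uniformC1_field₀ (ε / 4) (by positivity)).reindex fun _ : ℝ => ()).comp_affine
      (by positivity) (fun _ => le_rfl) fun _ _ _ => by ring
  rw [show B = fieldMap T P f₀ B₀ Z by funext t x; exact S.field_eq t x]
  refine (hinit.add hintegral).mono ?_
  have hPT : P * T ≤ 1 / 48 := by nlinarith [S.time_mul_le, S.cutoff_le, S.time_pos]
  calc ε / 4 + T * (2 * P * (2 * ε + N * ε))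
      = (1 / 4 + 4 * (P * T) + 2 * (N * P * T)) * ε := by ring
    _ ≤ ε / 2 := by nlinarith [S.mul_time_le]

/- The solution is Lipschitz, hence has bounded oscillation, and every bound for the oscillation
improves by a factor `2`. -/
theorem uniformC1_flow_and_field (S : IsTruncatedSolution N P T f₀ B₀ ψ Z B) :
    UniformC1 (fun (p : ℝ × ℝ) z => Z p.1 p.2 z) ∧ UniformC1 B := by
  have hN := S.nonneg
  set Osc : ℝ → Prop := fun ε =>
    IncrementOscLE ε (fun (p : ℝ × ℝ) z => Z p.1 p.2 z) ∧ IncrementOscLE ε B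
  have hclosed : IsClosed {A | ∀ ε > A, Osc ε} := by
    rw [show {A | ∀ ε > A, Osc ε} = ⋂ ε ∈ {ε | ¬Osc ε}, Ici ε by ext; simp; grind]
    exact isClosed_biInter fun _ _ => isClosed_Ici
  have hbound : 2 * (N + 1) + 2 ∈ {A | ∀ ε > A, Osc ε} := fun ε hε =>
    ⟨(IncrementOscLE.of_lipschitz fun p => S.flow_lip p.1 p.2).mono (by linarith),
      (IncrementOscLE.of_lipschitz S.field_lip).mono (by linarith)⟩
  have hzero := two_mul_mem_of_add_half_mem hclosed le_rfl (by positivity) hbound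
    fun A hA hA0 ε hε => by
      have hε' : 0 < ε := by linarith
      obtain ⟨hZ, hB⟩ := hA (2 * ε) (by linarith)
      have hhalf : 2 * ε / 2 = ε := by ring
      exact hhalf ▸ ⟨S.incrementOscLE_flow_half (by positivity) hZ hB,
        S.incrementOscLE_field_half (by positivity) hZ⟩
  rw [mul_zero] at hzero
  exact ⟨fun ε hε => (hzero ε hε).1, fun ε hε => (hzero ε hε).2⟩

theorem uniformC1_density (S : IsTruncatedSolution N P T f₀ B₀ ψ Z B) :
    UniformC1 fun (t : ℝ) z => f₀ (Z 0 t z) := by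
  intro ε hε
  have hN := S.nonneg
  have hε' : 0 < ε / (2 + N) := by positivity
  refine (((S.uniformC1_density₀ _ hε').reindex fun _ => ()).comp hε'.le hN
    (fun _ => S.density₀_lip) ((S.uniformC1_flow_and_field.1 _ hε').reindex fun t : ℝ => (0, t))
    zero_le_two fun _ => S.flow_lip _ _).mono (le_of_eq ?_)
  field_simp

theorem differentiable_density (S : IsTruncatedSolution N P T f₀ B₀ ψ Z B) (t : ℝ) :
    Differentiable ℝ fun z => f₀ (Z 0 t z) := by
  refine S.uniformC1_density.differentiable (L := (N * 2).toNNReal)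
    (fun t => LipschitzWith.of_dist_le' fun z z' => ?_) t
  rw [dist_eq_norm, dist_eq_norm, mul_assoc]
  exact (S.density₀_lip _ _).trans (mul_le_mul_of_nonneg_left (S.flow_lip _ _ _ _) S.nonneg)

theorem continuous_fderiv_density (S : IsTruncatedSolution N P T f₀ B₀ ψ Z B) :
    Continuous fun p : ℝ × ℝ × ℝ => fderiv ℝ (fun z => f₀ (Z 0 p.1 z)) p.2 :=
  continuous_clm_apply.2 (S.uniformC1_density.continuous_fderiv_apply S.differentiable_density
    (continuous_density_flow S.continuous_density₀ S.continuous_flow))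

theorem differentiable_field (S : IsTruncatedSolution N P T f₀ B₀ ψ Z B) (t : ℝ) :
    Differentiable ℝ (B t) :=
  S.uniformC1_flow_and_field.2.differentiable (L := (N + 1).toNNReal)
    (fun t => LipschitzWith.of_dist_le' fun x y => S.field_lip t x y) t

theorem continuous_fderiv_field (S : IsTruncatedSolution N P T f₀ B₀ ψ Z B) :
    Continuous fun p : ℝ × ℝ => fderiv ℝ (B p.1) p.2 :=
  continuous_clm_apply.2 (S.uniformC1_flow_and_field.2.continuous_fderiv_apply
    S.differentiable_field S.continuous_field)

theorem hasDerivAt_flow_start (S : IsTruncatedSolution N P T f₀ B₀ ψ Z B) (ht : t ∈ Ioo (-T) T)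
    (z : ℝ × ℝ) : HasDerivAt (fun r => Z t r z) (-force ψ B t z) t := by
  have hintegral := (hasDerivAt_integral_left_diag (H := fun τ r => force ψ B τ (Z τ r z))
    (S.continuous_force_flow.comp (by fun_prop : Continuous fun p : ℝ × ℝ => (p.1, p.2, z)))
    t).const_add z
  rw [S.flow_self] at hintegral
  refine hintegral.congr_of_eventuallyEq ?_
  filter_upwards [isOpen_Ioo.mem_nhds ht] with r hr
  rw [S.flow_eq, flowMap, clamp_of_abs_le (abs_lt.2 hr).le, clamp_of_abs_le (abs_lt.2 ht).le]

/- By the flow property the density at time `r` is the density at time `t` composed with `Z t r`. -/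
theorem hasDerivAt_density_time (S : IsTruncatedSolution N P T f₀ B₀ ψ Z B)
    (ht : t ∈ Ioo (-T) T) (z : ℝ × ℝ) : HasDerivAt (fun s => f₀ (Z 0 s z))
      (-fderiv ℝ (fun z => f₀ (Z 0 t z)) z (force ψ B t z)) t := by
  have hspace : HasFDerivAt (fun z => f₀ (Z 0 t z)) (fderiv ℝ (fun z => f₀ (Z 0 t z)) z)
      (Z t t z) := by
    rw [S.flow_self]
    exact (S.differentiable_density t z).hasFDerivAt
  have hcomp := hspace.comp_hasDerivAt t (S.hasDerivAt_flow_start ht z)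
  rw [map_neg] at hcomp
  exact hcomp.congr_of_eventuallyEq (.of_forall fun r => by simp only [Function.comp, S.flow_flow])

theorem contDiffOn_density (S : IsTruncatedSolution N P T f₀ B₀ ψ Z B) :
    ContDiffOn ℝ 1 (fun p : ℝ × ℝ × ℝ => f₀ (Z 0 p.1 p.2)) (Ioo (-T) T ×ˢ univ) :=
  contDiffOn_of_partial isOpen_Ioo (F := fun t z => f₀ (Z 0 t z))
    (fun _ ht z => S.hasDerivAt_density_time ht z)
    (fun t _ z => (S.differentiable_density t z).hasFDerivAt)
    (S.continuous_fderiv_density.clm_apply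
      (continuous_force S.continuous_speed S.continuous_field)).neg
    S.continuous_fderiv_density

theorem hasDerivAt_field_line (S : IsTruncatedSolution N P T f₀ B₀ ψ Z B)
    (ht : t ∈ Ioo (-T) T) (y : ℝ) :
    HasDerivAt (fun s => B s (y + s)) (∫ w in -P..P, f₀ (Z 0 t (y + t, w))) t := by
  have hcharge : Continuous fun σ : ℝ => ∫ w in -P..P, f₀ (Z 0 σ (y + σ, w)) :=
    (continuous_charge S.continuous_density₀ S.continuous_flow).comp
      (by fun_prop : Continuous fun σ : ℝ => (σ, y + σ))
  refine ((hcharge.integral_hasStrictDerivAt 0 t).hasDerivAt.const_add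
    (B₀ y)).congr_of_eventuallyEq ?_
  filter_upwards [isOpen_Ioo.mem_nhds ht] with s hs
  rw [S.field_eq, fieldMap, clamp_of_abs_le (abs_lt.2 hs).le, add_sub_cancel_right]

theorem contDiffOn_field (S : IsTruncatedSolution N P T f₀ B₀ ψ Z B) :
    ContDiffOn ℝ 1 (fun p : ℝ × ℝ => B p.1 p.2) (Ioo (-T) T ×ˢ univ) := by
  have hline : ContDiffOn ℝ 1 (fun p : ℝ × ℝ => B p.1 (p.2 + p.1)) (Ioo (-T) T ×ˢ univ) := by
    have hshear : Continuous fun p : ℝ × ℝ => (p.1, p.2 + p.1) := by fun_prop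
    exact contDiffOn_of_partial isOpen_Ioo (F := fun t y => B t (y + t))
      (A := fun t y => fderiv ℝ (B t) (y + t)) (fun _ ht y => S.hasDerivAt_field_line ht y)
      (fun t _ y => (S.differentiable_field t (y + t)).hasFDerivAt.comp y
        ((hasFDerivAt_id y).add_const t))
      ((continuous_charge S.continuous_density₀ S.continuous_flow).comp hshear)
      (S.continuous_fderiv_field.comp hshear)
  have hshear_symm : ContDiff ℝ 1 fun p : ℝ × ℝ => (p.1, p.2 - p.1) := by fun_prop
  refine (hline.comp hshear_symm.contDiffOn (s := Ioo (-T) T ×ˢ univ)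
    fun p hp => ⟨hp.1, mem_univ _⟩).congr fun p _ => ?_
  simp only [Function.comp, sub_add_cancel]

theorem hasDerivAt_field_time (S : IsTruncatedSolution N P T f₀ B₀ ψ Z B)
    (ht : t ∈ Ioo (-T) T) (x : ℝ) :
    HasDerivAt (fun s => B s x) ((∫ w in -P..P, f₀ (Z 0 t (x, w))) - deriv (B t) x) t := by
  have hmem : Ioo (-T) T ×ˢ univ ∈ 𝓝 (t, x) := (isOpen_Ioo.prod isOpen_univ).mem_nhds ⟨ht, trivial⟩
  have hB := ((S.contDiffOn_field.contDiffAt hmem).differentiableAt one_ne_zero).hasFDerivAt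
  set B' := fderiv ℝ (fun p : ℝ × ℝ => B p.1 p.2) (t, x)
  have htime : HasDerivAt (fun s => B s x) (B' (1, 0)) t :=
    hB.comp_hasDerivAt (f := fun s => (s, x)) t ((hasDerivAt_id t).prodMk (hasDerivAt_const t x))
  have hspace : HasDerivAt (B t) (B' (0, 1)) x :=
    hB.comp_hasDerivAt (f := fun y => (t, y)) x ((hasDerivAt_const x t).prodMk (hasDerivAt_id x))
  have hB' : HasFDerivAt (fun p : ℝ × ℝ => B p.1 p.2) B' (t, x - t + t) := by
    rwa [sub_add_cancel]
  have hline : HasDerivAt (fun s => B s (x - t + s)) (B' (1, 1)) t :=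
    hB'.comp_hasDerivAt (f := fun s => (s, x - t + s)) t
      ((hasDerivAt_id t).prodMk ((hasDerivAt_id t).const_add (x - t)))
  have hcharge := S.hasDerivAt_field_line ht (x - t)
  rw [sub_add_cancel] at hcharge
  have hsum : B' (1, 1) = B' (1, 0) + B' (0, 1) := by rw [← map_add]; simp
  rwa [hcharge.unique hline, hspace.deriv, hsum, add_sub_cancel_right]

end IsTruncatedSolution

/-- A continuously differentiable cutoff function, equal to `1` on `[-r, r]` and vanishing outside
`[-(r + 1), r + 1]`. -/
structure IsCutoff (r : ℝ) (χ : ℝ → ℝ) : Prop where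
  contDiff : ContDiff ℝ 1 χ
  eq_one : ∀ x, |x| ≤ r → χ x = 1
  eq_zero : ∀ x, r + 1 ≤ |x| → χ x = 0
  abs_le_one : ∀ x, |χ x| ≤ 1

theorem exists_isCutoff {r : ℝ} (hr : 0 < r) : ∃ χ, IsCutoff r χ := by
  let b : ContDiffBump (0 : ℝ) := ⟨r, r + 1, hr, by linarith⟩
  exact ⟨b, b.contDiff, fun x hx => b.one_of_mem_closedBall (by simpa using hx),
    fun x hx => b.zero_of_le_dist (by simpa using hx),
    fun x => (abs_of_nonneg b.nonneg).trans_le b.le_one⟩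

namespace IsCutoff

variable {r C C' L : ℝ} {χ g : ℝ → ℝ}

theorem tsupport_subset (hχ : IsCutoff r χ) : tsupport χ ⊆ Icc (-(r + 1)) (r + 1) :=
  closure_minimal (fun x hx => abs_le.1 (not_lt.1 fun h => hx (hχ.eq_zero x h.le))) isClosed_Icc

theorem hasCompactSupport (hχ : IsCutoff r χ) : HasCompactSupport χ :=
  isCompact_Icc.of_isClosed_subset (isClosed_tsupport χ) hχ.tsupport_subset

theorem abs_mul_le (hχ : IsCutoff r χ) (hC : 0 ≤ C) (hg : ∀ x, |x| ≤ r + 1 → |g x| ≤ C) (x : ℝ) :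
    |χ x * g x| ≤ C := by
  rcases le_total |x| (r + 1) with h | h
  · rw [abs_mul]
    exact (mul_le_of_le_one_left (abs_nonneg _) (hχ.abs_le_one x)).trans (hg x h)
  · rwa [hχ.eq_zero x h, zero_mul, abs_zero]

theorem abs_deriv_mul_le (hχ : IsCutoff r χ) (hL : ∀ x, |deriv χ x| ≤ L) (hC : 0 ≤ C)
    (hg : ∀ x, |x| ≤ r + 1 → |g x| ≤ C) (x : ℝ) : |deriv χ x * g x| ≤ L * C := by
  have hL0 : 0 ≤ L := (abs_nonneg _).trans (hL 0)
  rw [abs_mul]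
  by_cases hx : x ∈ tsupport χ
  · exact mul_le_mul (hL x) (hg x (abs_le.2 (hχ.tsupport_subset hx))) (abs_nonneg _) hL0
  · rw [Function.notMem_support.1 fun h => hx (support_deriv_subset h), abs_zero, zero_mul]
    exact mul_nonneg hL0 hC

theorem abs_mul_sub_mul_le (hχ : IsCutoff r χ) (hL : ∀ x, |deriv χ x| ≤ L) (hg : ContDiff ℝ 1 g)
    (hC : 0 ≤ C) (hgC : ∀ x, |x| ≤ r + 1 → |g x| ≤ C) (hC' : 0 ≤ C')
    (hgC' : ∀ x, |x| ≤ r + 1 → |deriv g x| ≤ C') (x y : ℝ) :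
    |χ x * g x - χ y * g y| ≤ (L * C + C') * |x - y| := by
  have hderiv : ∀ z, HasDerivAt (fun x => χ x * g x) (deriv χ z * g z + χ z * deriv g z) z :=
    fun z => (hχ.contDiff.differentiable one_ne_zero z).hasDerivAt.mul
      (hg.differentiable one_ne_zero z).hasDerivAt
  exact convex_univ.norm_image_sub_le_of_norm_hasDerivWithin_le
    (fun z _ => (hderiv z).hasDerivWithinAt) (fun z _ => (norm_add_le _ _).trans
      (add_le_add (hχ.abs_deriv_mul_le hL hC hgC z) (hχ.abs_mul_le hC' hgC' z)))
    (mem_univ y) (mem_univ x)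

end IsCutoff

/-- Initial data with the bounds that control the time of existence. For the field only bounds near
the support of the density are required. -/
structure IsBoundedData (R A : ℝ) (f₀ : ℝ × ℝ → ℝ) (B₀ : ℝ → ℝ) : Prop where
  contDiff_density : ContDiff ℝ 1 f₀
  contDiff_field : ContDiff ℝ 1 B₀
  abs_le_of_ne_zero : ∀ x v, f₀ (x, v) ≠ 0 → |x| ≤ R ∧ |v| ≤ R
  abs_density_le : ∀ z, |f₀ z| ≤ A
  density_lip : ∀ z z', |f₀ z - f₀ z'| ≤ A * ‖z - z'‖
  abs_field_le : ∀ x, |x| ≤ R + 3 → |B₀ x| ≤ A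
  abs_deriv_field_le : ∀ x, |x| ≤ R + 3 → |deriv B₀ x| ≤ A

theorem IsBoundedData.hasCompactSupport {R A : ℝ} {f₀ : ℝ × ℝ → ℝ} {B₀ : ℝ → ℝ}
    (D : IsBoundedData R A f₀ B₀) : HasCompactSupport f₀ :=
  .intro (isCompact_Icc.prod isCompact_Icc : IsCompact (Icc (-R) R ×ˢ Icc (-R) R)) fun z hz => by
    by_contra h
    exact hz ((D.abs_le_of_ne_zero z.1 z.2 h).imp abs_le.1 abs_le.1)

theorem exists_truncatedData {R A : ℝ} (hR : 0 ≤ R) (hA : 0 ≤ A) {χ : ℝ → ℝ}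
    (hχ : IsCutoff (R + 2) χ) : ∃ N T, 0 < T ∧ ∀ f₀ B₀, IsBoundedData R A f₀ B₀ →
      TruncatedData N (R + 2) T f₀ (fun x => χ x * B₀ x) fun v => χ v * v := by
  obtain ⟨L, hL⟩ := hχ.hasCompactSupport.deriv.exists_bound_of_continuous
    (hχ.contDiff.continuous_deriv le_rfl)
  have hL0 : 0 ≤ L := (norm_nonneg _).trans (hL 0)
  obtain ⟨N, hN⟩ : ∃ N, N = (L * R + 3 * L + L * A) + (R + 3 + A) := ⟨_, rfl⟩
  have hLR : 0 ≤ L * R := mul_nonneg hL0 hR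
  have hLA : 0 ≤ L * A := mul_nonneg hL0 hA
  have hN0 : 0 ≤ N := by linarith
  refine ⟨N, 1 / (24 * (N + 1) ^ 2), by positivity, fun f₀ B₀ D => ?_⟩
  have hR3 : R + 2 + 1 = R + 3 := by ring
  have hfield := D.abs_field_le
  have hfield' := D.abs_deriv_field_le
  rw [← hR3] at hfield hfield'
  have hdensity (z : ℝ × ℝ) : |f₀ z| ≤ N := (D.abs_density_le z).trans (by linarith)
  exact {
    one_le := by linarith
    cutoff_nonneg := by linarith
    cutoff_le := by linarith
    time_pos := by positivity
    time_mul_sq_le := le_of_eq (by field_simp)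
    abs_density₀_le := hdensity
    density₀_lip := fun z z' => (D.density_lip z z').trans (by gcongr; linarith)
    uniformC1_density₀ := .of_hasCompactSupport D.contDiff_density D.hasCompactSupport
    abs_field₀_le := fun x => (hχ.abs_mul_le hA hfield x).trans (by linarith)
    field₀_lip := fun x y => (hχ.abs_mul_sub_mul_le hL D.contDiff_field hA hfield hA hfield'
      x y).trans (by gcongr; linarith)
    uniformC1_field₀ := .of_hasCompactSupport (hχ.contDiff.mul D.contDiff_field)
      hχ.hasCompactSupport.mul_right
    abs_speed_le := hχ.abs_mul_le hN0 fun v hv => by linarith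
    speed_lip := fun v w => (hχ.abs_mul_sub_mul_le hL contDiff_id (C := R + 3) (by linarith)
      (fun v hv => hv.trans_eq hR3) zero_le_one (fun v _ => by simp) v w).trans
        (by gcongr; linarith)
    uniformC1_speed := .of_hasCompactSupport (hχ.contDiff.mul contDiff_id)
      hχ.hasCompactSupport.mul_right }

theorem IsClassicalSolution.of_hasDerivWithinAt {T : ℝ} {f₀ : ℝ × ℝ → ℝ} {B₀ : ℝ → ℝ}
    {f : ℝ → ℝ → ℝ → ℝ} {B : ℝ → ℝ → ℝ} (hT : 0 < T) (hf : IsDensityClass T f)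
    (hB : IsFieldClass T B)
    (hft : ∀ t ∈ Icc 0 T, ∀ x v, HasDerivWithinAt (fun s => f s x v)
      (-(v * deriv (fun y => f t y v) x) - B t x * deriv (fun w => f t x w) v) (Icc 0 T) t)
    (hBt : ∀ t ∈ Icc 0 T, ∀ x, HasDerivWithinAt (fun s => B s x)
      ((∫ v, f t x v) - deriv (fun y => B t y) x) (Icc 0 T) t)
    (hf₀ : ∀ x v, f 0 x v = f₀ (x, v)) (hB₀ : ∀ x, B 0 x = B₀ x) :
    IsClassicalSolution f₀ B₀ T f B where
  pos := hT
  density := hf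
  field := hB
  vlasov t ht x v := by
    rw [(hft t ht x v).derivWithin (uniqueDiffOn_Icc hT t ht)]
    ring
  transport t ht x := by
    rw [(hBt t ht x).derivWithin (uniqueDiffOn_Icc hT t ht)]
    ring
  init_density := hf₀
  init_field := hB₀

namespace IsTruncatedSolution

variable {N P T R t : ℝ} {f₀ : ℝ × ℝ → ℝ} {B₀ B₁ ψ : ℝ → ℝ} {Z : ℝ → ℝ → ℝ × ℝ → ℝ × ℝ}
  {B : ℝ → ℝ → ℝ}

theorem abs_le_of_density_ne_zero (S : IsTruncatedSolution N P T f₀ B₁ ψ Z B)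
    (hs : ∀ x v, f₀ (x, v) ≠ 0 → |x| ≤ R ∧ |v| ≤ R) {x v : ℝ} (hne : f₀ (Z 0 t (x, v)) ≠ 0) :
    |x| ≤ R + 1 ∧ |v| ≤ R + 1 := by
  obtain ⟨hx, hv⟩ := hs _ _ hne
  obtain ⟨hx', hv'⟩ := norm_prod_le_iff.1 (S.norm_flow_sub_le 0 t (x, v))
  simp only [Prod.fst_sub, Prod.snd_sub, Real.norm_eq_abs] at hx' hv'
  rw [abs_sub_comm] at hx' hv'
  exact ⟨by linarith [abs_sub_abs_le_abs_sub x (Z 0 t (x, v)).1],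
    by linarith [abs_sub_abs_le_abs_sub v (Z 0 t (x, v)).2]⟩

theorem hasDerivAt_density_position (S : IsTruncatedSolution N P T f₀ B₁ ψ Z B) (t x v : ℝ) :
    HasDerivAt (fun y => f₀ (Z 0 t (y, v)))
      (fderiv ℝ (fun z => f₀ (Z 0 t z)) (x, v) (1, 0)) x :=
  (S.differentiable_density t (x, v)).hasFDerivAt.comp_hasDerivAt (f := fun y => (y, v)) x
    ((hasDerivAt_id x).prodMk (hasDerivAt_const x v))

theorem hasDerivAt_density_velocity (S : IsTruncatedSolution N P T f₀ B₁ ψ Z B) (t x v : ℝ) :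
    HasDerivAt (fun w => f₀ (Z 0 t (x, w)))
      (fderiv ℝ (fun z => f₀ (Z 0 t z)) (x, v) (0, 1)) v :=
  (S.differentiable_density t (x, v)).hasFDerivAt.comp_hasDerivAt (f := fun w => (x, w)) v
    ((hasDerivAt_const v x).prodMk (hasDerivAt_id v))

/- The truncated characteristic equations differ from the original ones only where the density
vanishes. -/
theorem hasDerivAt_density_time_of_eq (S : IsTruncatedSolution N P T f₀ B₁ ψ Z B)
    (hs : ∀ x v, f₀ (x, v) ≠ 0 → |x| ≤ R ∧ |v| ≤ R) (ht : t ∈ Ioo (-T) T) {x v b : ℝ}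
    (hψ : |v| ≤ R + 1 → ψ v = v) (hb : |x| ≤ R + 1 → B t x = b) :
    HasDerivAt (fun s => f₀ (Z 0 s (x, v)))
      (-(v * deriv (fun y => f₀ (Z 0 t (y, v))) x)
        - b * deriv (fun w => f₀ (Z 0 t (x, w))) v) t := by
  have hposition : (ψ v - v) * deriv (fun y => f₀ (Z 0 t (y, v))) x = 0 := by
    by_cases hv : |v| ≤ R + 1
    · rw [hψ hv, sub_self, zero_mul]
    · have hzero : (fun y => f₀ (Z 0 t (y, v))) = fun _ => 0 := funext fun y =>
        not_not.1 fun hne => hv (S.abs_le_of_density_ne_zero hs hne).2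
      rw [hzero, deriv_const, mul_zero]
  have hvelocity : (B t x - b) * deriv (fun w => f₀ (Z 0 t (x, w))) v = 0 := by
    by_cases hx : |x| ≤ R + 1
    · rw [hb hx, sub_self, zero_mul]
    · have hzero : (fun w => f₀ (Z 0 t (x, w))) = fun _ => 0 := funext fun w =>
        not_not.1 fun hne => hx (S.abs_le_of_density_ne_zero hs hne).1
      rw [hzero, deriv_const, mul_zero]
  have hforce : force ψ B t (x, v) = ψ v • ((1 : ℝ), (0 : ℝ)) + B t x • ((0 : ℝ), (1 : ℝ)) := by
    simp [force]
  refine (S.hasDerivAt_density_time ht (x, v)).congr_deriv ?_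
  rw [hforce, map_add, map_smul, map_smul, ← (S.hasDerivAt_density_position t x v).deriv,
    ← (S.hasDerivAt_density_velocity t x v).deriv, smul_eq_mul, smul_eq_mul]
  linear_combination -hposition - hvelocity

theorem integral_density_eq (S : IsTruncatedSolution N P T f₀ B₁ ψ Z B)
    (hs : ∀ x v, f₀ (x, v) ≠ 0 → |x| ≤ R ∧ |v| ≤ R) (hP : R + 1 < P) (t x : ℝ) :
    ∫ v, f₀ (Z 0 t (x, v)) = ∫ v in -P..P, f₀ (Z 0 t (x, v)) := by
  rw [intervalIntegral.integral_of_le (by linarith [S.cutoff_nonneg])]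
  refine (MeasureTheory.setIntegral_eq_integral_of_forall_compl_eq_zero fun v hv => ?_).symm
  by_contra hne
  obtain ⟨hv₁, hv₂⟩ := abs_le.1 (S.abs_le_of_density_ne_zero hs hne).2
  exact hv ⟨by linarith, by linarith⟩

theorem hasDerivAt_field_add_time (S : IsTruncatedSolution N P T f₀ B₁ ψ Z B)
    (ht : t ∈ Ioo (-T) T) {g : ℝ → ℝ} (hg : Differentiable ℝ g) (x : ℝ) :
    HasDerivAt (fun s => B s x + g (x - s))
      ((∫ w in -P..P, f₀ (Z 0 t (x, w))) - deriv (fun y => B t y + g (y - t)) x) t := by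
  have hspace : HasDerivAt (fun y => g (y - t)) (deriv g (x - t)) x :=
    (hg (x - t)).hasDerivAt.comp_sub_const x t
  have htime : HasDerivAt (fun s => g (x - s)) (-deriv g (x - t)) t :=
    (hg (x - t)).hasDerivAt.comp_const_sub x t
  have hsum : deriv (fun y => B t y + g (y - t)) x = deriv (B t) x + deriv g (x - t) :=
    ((S.differentiable_field t x).hasDerivAt.add hspace).deriv
  refine ((S.hasDerivAt_field_time ht x).add htime).congr_deriv ?_
  rw [hsum]
  ring

/- The part of the initial field that the truncation removes is carried along by free transport,
and stays away from the support of the density. -/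
theorem isClassicalSolution (S : IsTruncatedSolution N P T f₀ B₁ ψ Z B) {δ : ℝ}
    (hs : ∀ x v, f₀ (x, v) ≠ 0 → |x| ≤ R ∧ |v| ≤ R) (hP : R + 1 < P)
    (hψ : ∀ v, |v| ≤ R + 1 → ψ v = v) (hB₀ : ContDiff ℝ 1 B₀) (hB₁ : ContDiff ℝ 1 B₁)
    (heq : ∀ x, |x| ≤ R + 2 → B₁ x = B₀ x) (hδ : 0 < δ) (hδT : δ < T) :
    IsClassicalSolution f₀ B₀ δ (fun t x v => f₀ (Z 0 t (x, v)))
      fun t x => B t x + (B₀ (x - t) - B₁ (x - t)) := by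
  have hsub : Icc 0 δ ⊆ Ioo (-T) T := fun t ht => ⟨by linarith [ht.1], ht.2.trans_lt hδT⟩
  have hg : ContDiff ℝ 1 fun x => B₀ x - B₁ x := hB₀.sub hB₁
  have hT : T ≤ 1 := by nlinarith [S.time_mul_le, S.nonneg, S.time_pos]
  have hfield : ∀ t ∈ Icc 0 δ, ∀ x, |x| ≤ R + 1 → B t x = B t x + (B₀ (x - t) - B₁ (x - t)) :=
    fun t ht x hx => by
      have ht' : |t| ≤ 1 := by rw [abs_of_nonneg ht.1]; linarith [ht.2]
      rw [heq _ ((abs_sub x t).trans (by linarith)), sub_self, add_zero]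
  refine .of_hasDerivWithinAt hδ ⟨S.contDiffOn_density.mono (prod_mono_left hsub),
    Icc (-(R + 1)) (R + 1) ×ˢ Icc (-(R + 1)) (R + 1), isCompact_Icc.prod isCompact_Icc,
    fun t _ x v hxv => ?_⟩ ?_ (fun t ht x v => ?_) (fun t ht x => ?_) (fun x v => ?_) fun x => ?_
  · by_contra hne
    exact hxv ((S.abs_le_of_density_ne_zero hs hne).imp abs_le.1 abs_le.1)
  · exact (S.contDiffOn_field.mono (prod_mono_left hsub)).add
      (hg.comp (by fun_prop : ContDiff ℝ 1 fun p : ℝ × ℝ => p.2 - p.1)).contDiffOn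
  · exact (S.hasDerivAt_density_time_of_eq hs (hsub ht) (hψ v)
      (hfield t ht x)).hasDerivWithinAt
  · rw [S.integral_density_eq hs hP]
    exact (S.hasDerivAt_field_add_time (hsub ht) (hg.differentiable one_ne_zero)
      x).hasDerivWithinAt
  · rw [S.flow_self]
  · simp [S.field_eq, fieldMap, clamp_of_abs_le (abs_zero.trans_le S.time_pos.le)]

end IsTruncatedSolution

theorem exists_isClassicalSolution_of_isBoundedData {R A : ℝ} (hR : 0 ≤ R) (hA : 0 ≤ A) :
    ∃ δ > 0, ∀ (f₀ : ℝ × ℝ → ℝ) (B₀ : ℝ → ℝ), IsBoundedData R A f₀ B₀ →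
      ∃ f B, IsClassicalSolution f₀ B₀ δ f B := by
  obtain ⟨χ, hχ⟩ := exists_isCutoff (by linarith : 0 < R + 2)
  obtain ⟨N, T, hT, hN⟩ := exists_truncatedData hR hA hχ
  refine ⟨T / 2, half_pos hT, fun f₀ B₀ D => ?_⟩
  obtain ⟨Z, B, S⟩ := (hN f₀ B₀ D).exists_isTruncatedSolution
  exact ⟨_, _, S.isClassicalSolution D.abs_le_of_ne_zero (by linarith)
    (fun v hv => by rw [hχ.eq_one v (by linarith), one_mul]) D.contDiff_field
    (hχ.contDiff.mul D.contDiff_field) (fun x hx => by rw [hχ.eq_one x hx, one_mul])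
    (half_pos hT) (half_lt_self hT)⟩

theorem prod_univ_mem_nhdsWithin {E : Type*} [TopologicalSpace E] {s s' : Set ℝ}
    {p : ℝ × E} (h : s ∈ 𝓝[s'] p.1) :
    s ×ˢ (univ : Set E) ∈ 𝓝[s' ×ˢ univ] p := by
  rw [← Prod.mk.eta (p := p), nhdsWithin_prod_eq]
  exact prod_mem_prod h (by simp)

section Overlap

variable {E : Type*} [NormedAddCommGroup E] [NormedSpace ℝ E] {F : ℝ × E → ℝ} {u : ℝ → ℝ}
  {t t₀ T₁ T₂ d : ℝ}

theorem Icc_left_mem_nhdsWithin (ht : t < T₁) : Icc 0 T₁ ∈ 𝓝[Icc 0 T₂] t := by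
  filter_upwards [self_mem_nhdsWithin, mem_nhdsWithin_of_mem_nhds (Iio_mem_nhds ht)] with s hs hs'
  exact ⟨hs.1, le_of_lt hs'⟩

theorem Icc_right_mem_nhdsWithin (ht : t₀ < t) : Icc t₀ T₂ ∈ 𝓝[Icc 0 T₂] t := by
  filter_upwards [self_mem_nhdsWithin, mem_nhdsWithin_of_mem_nhds (Ioi_mem_nhds ht)] with s hs hs'
  exact ⟨le_of_lt hs', hs.2⟩

theorem contDiffOn_of_overlap (ht₀ : t₀ < T₁) (h : ContDiffOn ℝ 1 F (Icc 0 T₁ ×ˢ univ))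
    (h' : ContDiffOn ℝ 1 F (Icc t₀ T₂ ×ˢ univ)) : ContDiffOn ℝ 1 F (Icc 0 T₂ ×ˢ univ) := by
  intro p hp
  rcases lt_or_ge p.1 T₁ with hlt | hge
  · exact (h p ⟨⟨hp.1.1, hlt.le⟩, hp.2⟩).mono_of_mem_nhdsWithin
      (prod_univ_mem_nhdsWithin (Icc_left_mem_nhdsWithin hlt))
  · have hgt := ht₀.trans_le hge
    exact (h' p ⟨⟨hgt.le, hp.1.2⟩, hp.2⟩).mono_of_mem_nhdsWithin
      (prod_univ_mem_nhdsWithin (Icc_right_mem_nhdsWithin hgt))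

theorem hasDerivWithinAt_of_overlap (ht₀ : t₀ < T₁)
    (h : t ≤ T₁ → HasDerivWithinAt u d (Icc 0 T₁) t)
    (h' : t₀ ≤ t → HasDerivWithinAt u d (Icc t₀ T₂) t) : HasDerivWithinAt u d (Icc 0 T₂) t := by
  rcases lt_or_ge t T₁ with hlt | hge
  · exact (h hlt.le).mono_of_mem_nhdsWithin (Icc_left_mem_nhdsWithin hlt)
  · have hgt := ht₀.trans_le hge
    exact (h' hgt.le).mono_of_mem_nhdsWithin (Icc_right_mem_nhdsWithin hgt)

theorem contDiffOn_Icc_of_shift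
    (h : ContDiffOn ℝ 1 (fun p : ℝ × E => F (t₀ + p.1, p.2)) (Icc 0 (T₂ - t₀) ×ˢ univ)) :
    ContDiffOn ℝ 1 F (Icc t₀ T₂ ×ˢ univ) := by
  refine (h.comp (by fun_prop : ContDiff ℝ 1 fun p : ℝ × E => (p.1 - t₀, p.2)).contDiffOn
    fun p hp => ⟨⟨sub_nonneg.2 hp.1.1, sub_le_sub_right hp.1.2 t₀⟩, hp.2⟩).congr fun p _ => ?_
  simp only [Function.comp, add_sub_cancel]

theorem hasDerivWithinAt_Icc_of_shift
    (h : HasDerivWithinAt (fun s => u (t₀ + s)) d (Icc 0 (T₂ - t₀)) (t - t₀)) :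
    HasDerivWithinAt u d (Icc t₀ T₂) t := by
  have hmaps : MapsTo (fun s => s - t₀) (Icc t₀ T₂) (Icc 0 (T₂ - t₀)) := fun s hs =>
    ⟨sub_nonneg.2 hs.1, sub_le_sub_right hs.2 t₀⟩
  have hsub : HasDerivWithinAt (fun s => s - t₀) 1 (Icc t₀ T₂) t :=
    (hasDerivWithinAt_id t _).sub_const t₀
  simpa only [Function.comp_def, add_sub_cancel, mul_one] using h.comp t hsub hmaps

end Overlap

section Gluing

variable {T : ℝ} {f₀ : ℝ × ℝ → ℝ} {B₀ : ℝ → ℝ} {f : ℝ → ℝ → ℝ → ℝ} {B : ℝ → ℝ → ℝ}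

namespace IsClassicalSolution

theorem hasDerivWithinAt_density_time (h : IsClassicalSolution f₀ B₀ T f B) {t : ℝ}
    (ht : t ∈ Icc 0 T) (x v : ℝ) : HasDerivWithinAt (fun s => f s x v)
      (-(v * deriv (fun y => f t y v) x) - B t x * deriv (fun w => f t x w) v) (Icc 0 T) t :=
  (h.density.hasDerivWithinAt_time ht x v).differentiableWithinAt.hasDerivWithinAt.congr_deriv
    (by linarith [h.vlasov t ht x v])

theorem hasDerivWithinAt_field_time (h : IsClassicalSolution f₀ B₀ T f B) {t : ℝ}
    (ht : t ∈ Icc 0 T) (x : ℝ) : HasDerivWithinAt (fun s => B s x)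
      ((∫ v, f t x v) - deriv (fun y => B t y) x) (Icc 0 T) t :=
  (h.field.hasDerivWithinAt_time ht x).differentiableWithinAt.hasDerivWithinAt.congr_deriv
    (by linarith [h.transport t ht x])

theorem restrict (h : IsClassicalSolution f₀ B₀ T f B) {S : ℝ} (hS : 0 < S) (hST : S ≤ T) :
    IsClassicalSolution f₀ B₀ S f B := by
  have hsub : Icc 0 S ⊆ Icc 0 T := Icc_subset_Icc_right hST
  obtain ⟨hf, K, hK, hfK⟩ := h.density
  exact .of_hasDerivWithinAt hS
    ⟨hf.mono (prod_mono_left hsub), K, hK, fun t ht => hfK t (hsub ht)⟩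
    (ContDiffOn.mono h.field (prod_mono_left hsub))
    (fun t ht x v => (h.hasDerivWithinAt_density_time (hsub ht) x v).mono hsub)
    (fun t ht x => (h.hasDerivWithinAt_field_time (hsub ht) x).mono hsub)
    h.init_density h.init_field

theorem congr (h : IsClassicalSolution f₀ B₀ T f B) {g : ℝ → ℝ → ℝ → ℝ} {D : ℝ → ℝ → ℝ}
    (hg : ∀ t ∈ Icc 0 T, g t = f t) (hD : ∀ t ∈ Icc 0 T, D t = B t) :
    IsClassicalSolution f₀ B₀ T g D := by
  have h0 : (0 : ℝ) ∈ Icc 0 T := left_mem_Icc.2 h.pos.le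
  obtain ⟨hf, K, hK, hfK⟩ := h.density
  refine .of_hasDerivWithinAt h.pos
    ⟨hf.congr fun p hp => by rw [hg p.1 hp.1], K, hK, fun t ht => by rw [hg t ht]; exact hfK t ht⟩
    (ContDiffOn.congr h.field fun p hp => by rw [hD p.1 hp.1])
    (fun t ht x v => ?_) (fun t ht x => ?_) ?_ ?_
  · rw [hg t ht, hD t ht]
    exact (h.hasDerivWithinAt_density_time ht x v).congr (fun s hs => by rw [hg s hs])
      (by rw [hg t ht])
  · rw [hg t ht, hD t ht]
    exact (h.hasDerivWithinAt_field_time ht x).congr (fun s hs => by rw [hD s hs])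
      (by rw [hD t ht])
  · rw [hg 0 h0]
    exact h.init_density
  · rw [hD 0 h0]
    exact h.init_field

theorem shift (h : IsClassicalSolution f₀ B₀ T f B) {t₀ : ℝ} (ht₀ : 0 ≤ t₀) (ht₀T : t₀ < T) :
    IsClassicalSolution (fun z => f t₀ z.1 z.2) (B t₀) (T - t₀)
      (fun t => f (t₀ + t)) fun t => B (t₀ + t) := by
  have hsub : MapsTo (fun t => t₀ + t) (Icc 0 (T - t₀)) (Icc 0 T) := fun t ht =>
    ⟨add_nonneg ht₀ ht.1, le_sub_iff_add_le'.1 ht.2⟩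
  have hadd : ∀ t, HasDerivWithinAt (fun s => t₀ + s) 1 (Icc 0 (T - t₀)) t := fun t =>
    (hasDerivWithinAt_id t _).const_add t₀
  obtain ⟨hf, K, hK, hfK⟩ := h.density
  refine .of_hasDerivWithinAt (sub_pos.2 ht₀T) ⟨?_, K, hK, fun t ht => hfK _ (hsub ht)⟩ ?_
    (fun t ht x v => ?_) (fun t ht x => ?_) (fun x v => by rw [add_zero])
    fun x => by rw [add_zero]
  · exact hf.comp (by fun_prop : ContDiff ℝ 1 fun p : ℝ × ℝ × ℝ => (t₀ + p.1, p.2)).contDiffOn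
      fun p hp => ⟨hsub hp.1, hp.2⟩
  · exact ContDiffOn.comp h.field
      (by fun_prop : ContDiff ℝ 1 fun p : ℝ × ℝ => (t₀ + p.1, p.2)).contDiffOn
      fun p hp => ⟨hsub hp.1, hp.2⟩
  · simpa only [Function.comp_def, mul_one] using
      (h.hasDerivWithinAt_density_time (hsub ht) x v).comp t (hadd t) hsub
  · simpa only [Function.comp_def, mul_one] using
      (h.hasDerivWithinAt_field_time (hsub ht) x).comp t (hadd t) hsub

theorem glue {f₁ : ℝ × ℝ → ℝ} {B₁ : ℝ → ℝ} {t₀ T₁ T₂ : ℝ} (ht₀T : t₀ < T₁)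
    (h : IsClassicalSolution f₀ B₀ T₁ f B)
    (h' : IsClassicalSolution f₁ B₁ (T₂ - t₀) (fun t => f (t₀ + t)) fun t => B (t₀ + t))
    (hT : T₁ ≤ T₂) : IsClassicalSolution f₀ B₀ T₂ f B := by
  obtain ⟨hf, K, hK, hfK⟩ := h.density
  obtain ⟨hf', K', hK', hfK'⟩ := h'.density
  have hsub : ∀ t ∈ Icc 0 T₂, t₀ ≤ t → t - t₀ ∈ Icc 0 (T₂ - t₀) := fun t ht hle =>
    ⟨sub_nonneg.2 hle, sub_le_sub_right ht.2 t₀⟩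
  refine .of_hasDerivWithinAt (h.pos.trans_le hT)
    ⟨contDiffOn_of_overlap ht₀T hf (contDiffOn_Icc_of_shift hf'), K ∪ K', hK.union hK',
      fun t ht x v hxv => ?_⟩
    (contDiffOn_of_overlap ht₀T h.field (contDiffOn_Icc_of_shift h'.field))
    (fun t ht x v => hasDerivWithinAt_of_overlap ht₀T
      (fun hle => h.hasDerivWithinAt_density_time ⟨ht.1, hle⟩ x v)
      fun hle => hasDerivWithinAt_Icc_of_shift ?_)
    (fun t ht x => hasDerivWithinAt_of_overlap ht₀T
      (fun hle => h.hasDerivWithinAt_field_time ⟨ht.1, hle⟩ x)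
      fun hle => hasDerivWithinAt_Icc_of_shift ?_) h.init_density h.init_field
  · rw [mem_union, not_or] at hxv
    rcases le_total t T₁ with hle | hle
    · exact hfK t ⟨ht.1, hle⟩ x v hxv.1
    · simpa only [add_sub_cancel] using
        hfK' (t - t₀) (hsub t ht (ht₀T.le.trans hle)) x v hxv.2
  · simpa only [add_sub_cancel] using h'.hasDerivWithinAt_density_time (hsub t ht hle) x v
  · simpa only [add_sub_cancel] using h'.hasDerivWithinAt_field_time (hsub t ht hle) x

theorem extend {g : ℝ → ℝ → ℝ → ℝ} {D : ℝ → ℝ → ℝ} {t₀ δ : ℝ}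
    (h : IsClassicalSolution f₀ B₀ T f B) (ht₀ : 0 ≤ t₀) (ht₀T : t₀ < T)
    (h' : IsClassicalSolution (fun z => f t₀ z.1 z.2) (B t₀) δ g D) (hT : T ≤ t₀ + δ) :
    ∃ F C, IsClassicalSolution f₀ B₀ (t₀ + δ) F C := by
  classical
  have hoverlap := (h.shift ht₀ ht₀T).eq_of_eq_data (h'.restrict (by linarith) (by linarith))
  refine ⟨fun t => if t ≤ T then f t else g (t - t₀), fun t => if t ≤ T then B t else D (t - t₀),
    glue ht₀T (h.congr (fun t ht => if_pos ht.2) fun t ht => if_pos ht.2)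
      (f₁ := fun z => f t₀ z.1 z.2) (B₁ := B t₀) ?_ hT⟩
  rw [add_sub_cancel_left]
  refine h'.congr (fun t ht => ?_) fun t ht => ?_ <;> split_ifs with hle
  · funext x v
    exact (hoverlap t ⟨ht.1, by linarith⟩ x).1 v
  · rw [add_sub_cancel_left]
  · funext x
    exact (hoverlap t ⟨ht.1, by linarith⟩ x).2
  · rw [add_sub_cancel_left]

theorem le_lifespan (h : IsClassicalSolution f₀ B₀ T f B) : ENNReal.ofReal T ≤ lifespan f₀ B₀ :=
  le_iSup₂_of_le T ⟨f, B, h⟩ le_rfl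

theorem eq_of_lt {S S' t : ℝ} {f' : ℝ → ℝ → ℝ → ℝ} {B' : ℝ → ℝ → ℝ}
    (h : IsClassicalSolution f₀ B₀ S f B) (h' : IsClassicalSolution f₀ B₀ S' f' B') (ht : 0 ≤ t)
    (htS : t < S) (htS' : t < S') : f t = f' t ∧ B t = B' t := by
  have hmin : 0 < min S S' := lt_min h.pos h'.pos
  have heq := (h.restrict hmin (min_le_left _ _)).eq_of_eq_data
    (h'.restrict hmin (min_le_right _ _)) t ⟨ht, le_min htS.le htS'.le⟩
  exact ⟨funext fun x => funext (heq x).1, funext fun x => (heq x).2⟩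

end IsClassicalSolution

theorem exists_isClassicalSolution_of_lt_lifespan (hT : ENNReal.ofReal T < lifespan f₀ B₀) :
    ∃ S > T, ∃ f B, IsClassicalSolution f₀ B₀ S f B := by
  simp only [lifespan, lt_iSup_iff] at hT
  obtain ⟨S, ⟨f, B, h⟩, hS⟩ := hT
  exact ⟨S, (ENNReal.ofReal_lt_ofReal_iff h.pos).1 hS, f, B, h⟩

theorem exists_isMaximalSolution (f₀ : ℝ × ℝ → ℝ) (B₀ : ℝ → ℝ) :
    ∃ f B, IsMaximalSolution f₀ B₀ f B := by
  have hvalue : ∀ t : ℝ, ∃ (ft : ℝ → ℝ → ℝ) (Bt : ℝ → ℝ), ∀ S f B, 0 ≤ t → t < S →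
      IsClassicalSolution f₀ B₀ S f B → ft = f t ∧ Bt = B t := by
    intro t
    by_cases hex : ∃ S f B, t < S ∧ IsClassicalSolution f₀ B₀ S f B
    · obtain ⟨S, f, B, htS, h⟩ := hex
      exact ⟨f t, B t, fun S' f' B' ht htS' h' => h.eq_of_lt h' ht htS htS'⟩
    · exact ⟨0, 0, fun S f B _ htS h => (hex ⟨S, f, B, htS, h⟩).elim⟩
  choose f B hfB using hvalue
  refine ⟨f, B, fun T hT hlt => ?_⟩
  obtain ⟨S, hS, f', B', h⟩ := exists_isClassicalSolution_of_lt_lifespan hlt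
  exact (h.restrict hT hS.le).congr
    (fun t ht => (hfB t S f' B' ht.1 (ht.2.trans_lt hS) h).1)
    fun t ht => (hfB t S f' B' ht.1 (ht.2.trans_lt hS) h).2

end Gluing

section Continuation

variable {T : ℝ} {f₀ : ℝ × ℝ → ℝ} {B₀ : ℝ → ℝ} {f : ℝ → ℝ → ℝ → ℝ} {B : ℝ → ℝ → ℝ}

theorem IsDensityClass.contDiff_slice (hf : IsDensityClass T f) {t : ℝ} (ht : t ∈ Icc 0 T) :
    ContDiff ℝ 1 fun z : ℝ × ℝ => f t z.1 z.2 := by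
  rw [← contDiffOn_univ]
  exact hf.1.comp (by fun_prop : ContDiff ℝ 1 fun z : ℝ × ℝ => (t, z)).contDiffOn
    fun z _ => ⟨ht, mem_univ _⟩

theorem IsFieldClass.contDiff_slice (hB : IsFieldClass T B) {t : ℝ} (ht : t ∈ Icc 0 T) :
    ContDiff ℝ 1 (B t) := by
  rw [← contDiffOn_univ]
  exact ContDiffOn.comp (g := fun p : ℝ × ℝ => B p.1 p.2) hB
    (by fun_prop : ContDiff ℝ 1 fun x : ℝ => (t, x)).contDiffOn fun z _ => ⟨ht, mem_univ _⟩

theorem IsDensityClass.abs_increment_le (hf : IsDensityClass T f) {t c : ℝ} (ht : t ∈ Icc 0 T)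
    (hc : ∀ x v, |deriv (fun y => f t y v) x| ≤ c ∧ |deriv (fun w => f t x w) v| ≤ c)
    (x v x' v' : ℝ) : |f t x v - f t x' v'| ≤ c * |x - x'| + c * |v - v'| := by
  have hposition : |f t x v - f t x' v| ≤ c * |x - x'| :=
    convex_univ.norm_image_sub_le_of_norm_deriv_le (f := fun y => f t y v)
      (fun y _ => (hf.hasDerivAt_position ht y v).differentiableAt) (fun y _ => (hc y v).1)
      (mem_univ x') (mem_univ x)
  have hvelocity : |f t x' v - f t x' v'| ≤ c * |v - v'| :=
    convex_univ.norm_image_sub_le_of_norm_deriv_le (f := fun w => f t x' w)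
      (fun w _ => (hf.hasDerivAt_velocity ht x' w).differentiableAt) (fun w _ => (hc x' w).2)
      (mem_univ v') (mem_univ v)
  exact (abs_sub_le _ (f t x' v) _).trans (add_le_add hposition hvelocity)

theorem exists_abs_sub_le_of_contDiff {g : ℝ → ℝ} (hg : ContDiff ℝ 1 g) (r : ℝ) :
    ∃ K ≥ 0, ∀ x y, |x| ≤ r → |y| ≤ r → |g x - g y| ≤ K * |x - y| := by
  obtain ⟨K, hK⟩ := (isCompact_Icc (a := -r) (b := r)).exists_bound_of_continuousOn
    (hg.continuous_deriv le_rfl).continuousOn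
  exact ⟨max K 0, le_max_right _ _, fun x y hx hy =>
    (convex_Icc (-r) r).norm_image_sub_le_of_norm_deriv_le
      (fun z _ => hg.differentiable one_ne_zero z)
      (fun z hz => (hK z hz).trans (le_max_left _ _)) (abs_le.1 hy) (abs_le.1 hx)⟩

theorem exists_abs_le_of_hasCompactSupport (hf₀c : HasCompactSupport f₀) :
    ∃ R ≥ 0, ∀ x v, f₀ (x, v) ≠ 0 → |x| ≤ R ∧ |v| ≤ R := by
  obtain ⟨R, hR⟩ := hf₀c.isCompact.isBounded.exists_norm_le
  exact ⟨max R 0, le_max_right _ _, fun x v hne =>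
    norm_prod_le_iff.1 ((hR _ (subset_tsupport _ hne)).trans (le_max_left _ _))⟩

theorem exists_isBoundedData (hf₀ : ContDiff ℝ 1 f₀) (hf₀c : HasCompactSupport f₀)
    (hB₀ : ContDiff ℝ 1 B₀) : ∃ R ≥ 0, ∃ A ≥ 0, IsBoundedData R A f₀ B₀ := by
  obtain ⟨R, hR0, hR⟩ := exists_abs_le_of_hasCompactSupport hf₀c
  obtain ⟨M, hM⟩ := hf₀c.exists_bound_of_continuous hf₀.continuous
  obtain ⟨L, hL⟩ := hf₀.lipschitzWith_of_hasCompactSupport hf₀c one_ne_zero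
  obtain ⟨C₁, hC₁⟩ := (isCompact_Icc (a := -(R + 3)) (b := R + 3)).exists_bound_of_continuousOn
    hB₀.continuous.continuousOn
  obtain ⟨C₂, hC₂⟩ := (isCompact_Icc (a := -(R + 3)) (b := R + 3)).exists_bound_of_continuousOn
    (hB₀.continuous_deriv le_rfl).continuousOn
  have hL_le : (L : ℝ) ≤ max (max M L) (max C₁ C₂) := (le_max_right _ _).trans (le_max_left _ _)
  refine ⟨R, hR0, max (max M L) (max C₁ C₂), L.2.trans hL_le, hf₀, hB₀, hR,
    fun z => (hM z).trans ((le_max_left _ _).trans (le_max_left _ _)), fun z z' => ?_,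
    fun x hx => (hC₁ x (abs_le.1 hx)).trans ((le_max_left _ _).trans (le_max_right _ _)),
    fun x hx => (hC₂ x (abs_le.1 hx)).trans ((le_max_right _ _).trans (le_max_right _ _))⟩
  exact (hL.norm_sub_le z z').trans (by gcongr)

theorem exists_isClassicalSolution (hf₀ : ContDiff ℝ 1 f₀) (hf₀c : HasCompactSupport f₀)
    (hB₀ : ContDiff ℝ 1 B₀) : ∃ T f B, IsClassicalSolution f₀ B₀ T f B := by
  obtain ⟨R, hR, A, hA, hdata⟩ := exists_isBoundedData hf₀ hf₀c hB₀
  obtain ⟨δ, -, hsolve⟩ := exists_isClassicalSolution_of_isBoundedData hR hA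
  exact ⟨δ, hsolve f₀ B₀ hdata⟩

theorem exists_forall_classicalSolution_bound (hf₀ : Continuous f₀) (hf₀c : HasCompactSupport f₀)
    {b S : ℝ} (hb : ∀ x, |B₀ x| ≤ b) (hS : 0 ≤ S) :
    ∃ r ≥ 0, ∀ T ≤ S, ∀ f B, IsClassicalSolution f₀ B₀ T f B → ∀ t ∈ Icc 0 T,
      (∀ x v, f t x v ≠ 0 → |x| ≤ r ∧ |v| ≤ r) ∧ (∀ x v, |f t x v| ≤ r) ∧ ∀ x, |B t x| ≤ r := by
  obtain ⟨R, hR0, hR⟩ := exists_abs_le_of_hasCompactSupport hf₀c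
  obtain ⟨M, hM⟩ := hf₀c.exists_bound_of_continuous hf₀
  have hM0 : 0 ≤ M := (norm_nonneg _).trans (hM 0)
  have hb0 : 0 ≤ b := (abs_nonneg _).trans (hb 0)
  set V := 2 * (R + b * S) * Real.exp ((4 * M + 1) * S) with hV
  have hV0 : 0 ≤ V := by positivity
  have hVS : 0 ≤ V * S := by positivity
  have hVMS : 0 ≤ 2 * V * M * S := by positivity
  refine ⟨R + V * S + V + M + (b + 2 * V * M * S), by positivity, fun T hTS f B h => ?_⟩
  have hvelocity : ∀ t ∈ Icc 0 T, ∀ x v, f t x v ≠ 0 → |v| ≤ V := fun t ht x v hne => by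
    refine (h.abs_velocity_le hM hR0 (fun x v hne => (hR x v hne).2) hb t ht x v hne).trans ?_
    rw [hV]
    gcongr
  have hdensity := h.abs_density_le hM
  have hcharge : ∀ t ∈ Icc 0 T, ∀ x, |∫ v, f t x v| ≤ 2 * V * M := fun t ht x =>
    abs_integral_le_of_support hV0 (hvelocity t ht x) (hdensity t ht x)
  intro t ht
  have htS : t ≤ S := ht.2.trans hTS
  refine ⟨fun x v hne => ⟨?_, ?_⟩, fun x v => ?_, fun x => ?_⟩
  · have hposition := h.abs_position_le (fun x v hne => (hR x v hne).1) hvelocity t ht x v hne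
    linarith [mul_le_mul_of_nonneg_left htS hV0]
  · linarith [hvelocity t ht x v hne]
  · linarith [hdensity t ht x v]
  · have hfield := h.abs_field_sub_le (fun s => hasDerivAt_const_mul (2 * V * M)) hcharge t ht x
    have htime : 2 * V * M * t ≤ 2 * V * M * S := by gcongr
    linarith [hb (x - t), abs_sub_abs_le_abs_sub (B t x) (B₀ (x - t))]

theorem IsClassicalSolution.abs_field_increment_le (h : IsClassicalSolution f₀ B₀ T f B)
    {c V : ℝ} (hV : 0 ≤ V) (hsupp : ∀ t ∈ Icc 0 T, ∀ x v, f t x v ≠ 0 → |v| ≤ V)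
    (hlip : ∀ t ∈ Icc 0 T, ∀ x y v, |f t x v - f t y v| ≤ c * |x - y|) {t : ℝ} (ht : t ∈ Icc 0 T)
    (x y : ℝ) : |B t x - B t y| ≤ |B₀ (x - t) - B₀ (y - t)| + 2 * V * (c * |x - y|) * t := by
  have hcharge : ∀ s ∈ Icc 0 T,
      |(∫ v, f s (x - t + s) v) - ∫ v, f s (y - t + s) v| ≤ 2 * V * (c * |x - y|) := by
    intro s hs
    have hint : ∀ z, MeasureTheory.Integrable fun v => f s z v := fun z =>
      integrable_of_support (h.density.continuous_velocity hs z) (hsupp s hs z)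
    rw [← MeasureTheory.integral_sub (hint _) (hint _)]
    refine abs_integral_le_of_support hV (fun v hv => ?_) fun v => ?_
    · by_cases hx : f s (x - t + s) v = 0
      · exact hsupp s hs (y - t + s) v fun hy => hv (by rw [hx, hy, sub_zero])
      · exact hsupp s hs _ v hx
    · simpa only [add_sub_add_right_eq_sub, sub_sub_sub_cancel_right] using
        hlip s hs (x - t + s) (y - t + s) v
  have hline := abs_sub_le_of_abs_deriv_le
    (fun s hs => (h.hasDerivWithinAt_field_line hs (x - t)).sub
      (h.hasDerivWithinAt_field_line hs (y - t)))
    (fun s => hasDerivAt_const_mul (2 * V * (c * |x - y|))) hcharge ht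
  simp only [Pi.sub_apply, sub_add_cancel, add_zero, h.init_field, mul_zero, sub_zero] at hline
  linarith [abs_sub_abs_le_abs_sub (B t x - B t y) (B₀ (x - t) - B₀ (y - t))]

theorem IsClassicalSolution.isBoundedData_slice (h : IsClassicalSolution f₀ B₀ T f B) {t r c L : ℝ}
    (ht : t ∈ Icc 0 T) (hr : 0 ≤ r) (hc : 0 ≤ c) (hL : 0 ≤ L)
    (hsupp : ∀ x v, f t x v ≠ 0 → |x| ≤ r ∧ |v| ≤ r) (hf : ∀ x v, |f t x v| ≤ r)
    (hB : ∀ x, |B t x| ≤ r)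
    (hgrad : ∀ x v, |deriv (fun y => f t y v) x| ≤ c ∧ |deriv (fun w => f t x w) v| ≤ c)
    (hlip : ∀ x y, |x| ≤ r + 4 → |y| ≤ r + 4 → |B t x - B t y| ≤ L * |x - y|) :
    IsBoundedData r (r + 2 * c + L) (fun z => f t z.1 z.2) (B t) where
  contDiff_density := h.density.contDiff_slice ht
  contDiff_field := h.field.contDiff_slice ht
  abs_le_of_ne_zero := hsupp
  abs_density_le z := (hf z.1 z.2).trans (by linarith)
  density_lip z z' := by
    have hfst : |z.1 - z'.1| ≤ ‖z - z'‖ := norm_fst_le (z - z')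
    have hsnd : |z.2 - z'.2| ≤ ‖z - z'‖ := norm_snd_le (z - z')
    calc |f t z.1 z.2 - f t z'.1 z'.2| ≤ c * |z.1 - z'.1| + c * |z.2 - z'.2| :=
          h.density.abs_increment_le ht hgrad _ _ _ _
      _ ≤ c * ‖z - z'‖ + c * ‖z - z'‖ := by gcongr
      _ = 2 * c * ‖z - z'‖ := by ring
      _ ≤ (r + 2 * c + L) * ‖z - z'‖ := by gcongr; linarith
  abs_field_le x _ := (hB x).trans (by linarith)
  abs_deriv_field_le x hx := by
    have hderiv : ‖deriv (B t) x‖ ≤ L := by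
      refine norm_deriv_le_of_lip' hL ?_
      filter_upwards [Metric.closedBall_mem_nhds x one_pos] with y hy
      rw [Metric.mem_closedBall, Real.dist_eq] at hy
      exact hlip y x (by linarith [abs_sub_abs_le_abs_sub y x]) (by linarith)
    exact hderiv.trans (by linarith)

theorem exists_isBoundedData_slice (hf₀ : Continuous f₀) (hf₀c : HasCompactSupport f₀)
    {b S t₁ c : ℝ} (hb : ∀ x, |B₀ x| ≤ b) (ht₁ : 0 < t₁) (ht₁S : t₁ < S) (hc : 0 ≤ c)
    (hsol : ∀ T ∈ Ioo 0 S, IsClassicalSolution f₀ B₀ T f B)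
    (hgrad : ∀ t ∈ Ico t₁ S, ∀ x v,
      |deriv (fun y => f t y v) x| ≤ c ∧ |deriv (fun w => f t x w) v| ≤ c) :
    ∃ R ≥ 0, ∃ A ≥ 0, ∀ t ∈ Ioo t₁ S, IsBoundedData R A (fun z => f t z.1 z.2) (B t) := by
  have hS0 : 0 < S := ht₁.trans ht₁S
  obtain ⟨r, hr0, hr⟩ := exists_forall_classicalSolution_bound hf₀ hf₀c hb hS0.le
  obtain ⟨K, hK0, hK⟩ := exists_abs_sub_le_of_contDiff
    ((hsol t₁ ⟨ht₁, ht₁S⟩).field.contDiff_slice ⟨ht₁.le, le_rfl⟩) (r + 4 + S)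
  refine ⟨r, hr0, r + 2 * c + (K + 2 * r * c * S), by positivity, fun t ⟨ht₁t, htS⟩ => ?_⟩
  have ht0 : 0 < t := ht₁.trans ht₁t
  have hshift : ∀ s ∈ Icc 0 (t - t₁), t₁ + s ∈ Icc 0 t := fun s hs =>
    ⟨add_nonneg ht₁.le hs.1, le_sub_iff_add_le'.1 hs.2⟩
  have h := hsol t ⟨ht0, htS⟩
  have hbound := hr t htS.le f B h
  obtain ⟨hsupp, hf, hB⟩ := hbound t ⟨ht0.le, le_rfl⟩
  refine h.isBoundedData_slice ⟨ht0.le, le_rfl⟩ hr0 hc (by positivity) hsupp hf hB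
    (hgrad t ⟨ht₁t.le, htS⟩) fun x y hx hy => ?_
  have hincrement := (h.shift ht₁.le ht₁t).abs_field_increment_le (c := c) hr0
    (fun s hs x v hne => ((hbound (t₁ + s) (hshift s hs)).1 x v hne).2)
    (fun s hs x y v => by
      simpa only [sub_self, abs_zero, mul_zero, add_zero] using
        h.density.abs_increment_le (hshift s hs)
          (hgrad (t₁ + s) ⟨le_add_of_nonneg_right hs.1, (hshift s hs).2.trans_lt htS⟩) x v y v)
    ⟨sub_nonneg.2 ht₁t.le, le_rfl⟩ x y
  rw [add_sub_cancel] at hincrement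
  have habs : |t - t₁| ≤ S := by rw [abs_of_pos (sub_pos.2 ht₁t)]; linarith
  have hfield := hK (x - (t - t₁)) (y - (t - t₁)) ((abs_sub _ _).trans (by linarith))
    ((abs_sub _ _).trans (by linarith))
  rw [sub_sub_sub_cancel_right] at hfield
  calc |B t x - B t y| ≤ K * |x - y| + 2 * r * (c * |x - y|) * (t - t₁) :=
        hincrement.trans (by gcongr)
    _ ≤ K * |x - y| + 2 * r * (c * |x - y|) * S := by gcongr; linarith
    _ = (K + 2 * r * c * S) * |x - y| := by ring

/- The slices of the solution are data with uniform bounds, so the local existence time does not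
shrink, and restarting close enough to the lifespan continues the solution beyond it. -/
theorem IsMaximalSolution.false_of_gradient_bound (hf₀ : Continuous f₀)
    (hf₀c : HasCompactSupport f₀) {b : ℝ} (hb : ∀ x, |B₀ x| ≤ b)
    (hmax : IsMaximalSolution f₀ B₀ f B) {S t₁ c : ℝ} (hS : lifespan f₀ B₀ = ENNReal.ofReal S)
    (ht₁ : 0 ≤ t₁) (ht₁S : t₁ < S) (hc : 0 ≤ c)
    (hgrad : ∀ t ∈ Ioo t₁ S, ∀ x v,
      |deriv (fun y => f t y v) x| ≤ c ∧ |deriv (fun w => f t x w) v| ≤ c) : False := by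
  have hS0 : 0 < S := ht₁.trans_lt ht₁S
  have hsol : ∀ T ∈ Ioo 0 S, IsClassicalSolution f₀ B₀ T f B := fun T hT =>
    hmax T hT.1 (by rw [hS]; exact (ENNReal.ofReal_lt_ofReal_iff hS0).2 hT.2)
  obtain ⟨t₂, ht₁₂, ht₂S⟩ := exists_between ht₁S
  have ht₂0 : 0 < t₂ := ht₁.trans_lt ht₁₂
  obtain ⟨R, hR, A, hA, hdata⟩ := exists_isBoundedData_slice hf₀ hf₀c hb ht₂0 ht₂S hc hsol
    fun t ht => hgrad t ⟨ht₁₂.trans_le ht.1, ht.2⟩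
  obtain ⟨δ, hδ, hsolve⟩ := exists_isClassicalSolution_of_isBoundedData hR hA
  obtain ⟨t₀, ht₀, ht₀S⟩ := exists_between (max_lt ht₂S (sub_lt_self S hδ))
  obtain ⟨ht₂₀, ht₀δ⟩ := max_lt_iff.1 ht₀
  have ht₀0 : 0 < t₀ := ht₂0.trans ht₂₀
  obtain ⟨g, D, hrestart⟩ := hsolve _ _ (hdata t₀ ⟨ht₂₀, ht₀S⟩)
  obtain ⟨T, ht₀T, hTS⟩ := exists_between ht₀S
  obtain ⟨F, C, hFC⟩ :=
    (hsol T ⟨ht₀0.trans ht₀T, hTS⟩).extend ht₀0.le ht₀T hrestart (by linarith)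
  have hle := hFC.le_lifespan
  rw [hS, ENNReal.ofReal_le_ofReal_iff hS0.le] at hle
  linarith

theorem abs_deriv_le_of_gradientNorm_lt {t : ℝ} {c : NNReal} (hc : gradientNorm f t < c)
    (x v : ℝ) : |deriv (fun y => f t y v) x| ≤ c ∧ |deriv (fun w => f t x w) v| ≤ c := by
  have habs_le : ∀ d : ℝ, ‖d‖ₑ ≤ gradientNorm f t → |d| ≤ c := fun d hd =>
    enorm_le_coe.1 (hd.trans hc.le)
  exact ⟨habs_le _ (le_add_right (le_iSup₂ (f := fun x v => ‖deriv (fun y => f t y v) x‖ₑ) x v)),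
    habs_le _ (le_add_left (le_iSup₂ (f := fun x v => ‖deriv (fun w => f t x w) v‖ₑ) x v))⟩

theorem IsMaximalSolution.limsup_gradientNorm_eq_top (hf₀ : ContDiff ℝ 1 f₀)
    (hf₀c : HasCompactSupport f₀) (hB₀ : ContDiff ℝ 1 B₀) {b : ℝ} (hb : ∀ x, |B₀ x| ≤ b)
    (hmax : IsMaximalSolution f₀ B₀ f B) (hfin : lifespan f₀ B₀ ≠ ⊤) :
    limsup (fun t => gradientNorm f t) (𝓝[<] (lifespan f₀ B₀).toReal) = ⊤ := by
  by_contra hne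
  obtain ⟨c, hc, -⟩ := ENNReal.lt_iff_exists_nnreal_btwn.1 (lt_top_iff_ne_top.2 hne)
  obtain ⟨T, f', B', h⟩ := exists_isClassicalSolution hf₀ hf₀c hB₀
  have hpos : 0 < (lifespan f₀ B₀).toReal :=
    ENNReal.toReal_pos ((ENNReal.ofReal_pos.2 h.pos).trans_le h.le_lifespan).ne' hfin
  obtain ⟨t₁, ht₁, hsub⟩ := (mem_nhdsLT_iff_exists_mem_Ico_Ioo_subset hpos).1
    (eventually_lt_of_limsup_lt hc)
  exact hmax.false_of_gradient_bound hf₀.continuous hf₀c hb (ENNReal.ofReal_toReal hfin).symm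
    ht₁.1 ht₁.2 c.2 fun t ht => abs_deriv_le_of_gradientNorm_lt (hsub ht)

end Continuation

end VlasovField

theorem theorem3p1 (f₀ : ℝ × ℝ → ℝ) (B₀ : ℝ → ℝ)
    (hf₀ : ContDiff ℝ 1 f₀) (hf₀c : HasCompactSupport f₀) (hB₀ : ContDiff ℝ 1 B₀) :
    -- local existence
    (∃ T : ℝ, ∃ f B, VlasovField.IsClassicalSolution f₀ B₀ T f B) ∧
    -- uniqueness, on every time interval
    (∀ (T : ℝ) (f g : ℝ → ℝ → ℝ → ℝ) (B D : ℝ → ℝ → ℝ),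
      VlasovField.IsClassicalSolution f₀ B₀ T f B →
      VlasovField.IsClassicalSolution f₀ B₀ T g D →
      ∀ t ∈ Set.Icc 0 T, ∀ x : ℝ, (∀ v : ℝ, f t x v = g t x v) ∧ B t x = D t x) ∧
    -- the solution exists on the whole of `[0, T*)`
    (∃ f B, VlasovField.IsMaximalSolution f₀ B₀ f B) ∧
    -- blow-up of the gradient at a finite `T*`, for bounded initial field
    ((∃ C : ℝ, ∀ x : ℝ, |B₀ x| ≤ C) → VlasovField.lifespan f₀ B₀ ≠ ⊤ →
      ∀ f B, VlasovField.IsMaximalSolution f₀ B₀ f B →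
        Filter.limsup (fun t => VlasovField.gradientNorm f t)
          (nhdsWithin (VlasovField.lifespan f₀ B₀).toReal
            (Set.Iio (VlasovField.lifespan f₀ B₀).toReal)) = ⊤) :=
  ⟨VlasovField.exists_isClassicalSolution hf₀ hf₀c hB₀,
    fun _ _ _ _ _ h h' => h.eq_of_eq_data h',
    VlasovField.exists_isMaximalSolution f₀ B₀,
    fun ⟨_, hb⟩ hfin _ _ hmax => hmax.limsup_gradientNorm_eq_top hf₀ hf₀c hB₀ hb hfin⟩
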